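/- Let $K$ be an algebraically closed field and $\Gamma$ a quiver with finitely many vertices. Let $I$ be an ideal of the path algebra $K\Gamma$ which is contained in the ideal generated by the arrows and contains all paths of length at least $N$ for some $N$ (for instance, an admissible ideal), and suppose that $\Lambda = K\Gamma/I$ is finite dimensional over $K$. Products of paths are written so that $qp$ means "$q$ after $p$". Let $J$ be the Jacobson radical of $\Lambda$. Fix a sequence $e(0),\dots,e(l)$ of vertices of $\Gamma$, identified with the corresponding idempotents of $\Lambda$, let $\mathbb S=(S(0),\dots,S(l))$ be the sequence of simple left $\Lambda$-modules $S(i)=\Lambda e(i)/Je(i)$, and put $e=e(0)$ and $m=\dim_K\Lambda e-(l+1)$. Let $\mathcal G\text{-Uni}(\mathbb S)$ be the set of all $\Lambda$-submodules $C$ of $\Lambda e$ such that $\Lambda e/C$ is uniserial with consecutive composition factors $S(0),\dots,S(l)$, from the top to the socle. For a path $p\in K\Gamma\setminus I$ through $\mathbb S$, that is, $p=\gamma_l\cdots\gamma_1$ with arrows $\gamma_i: e(i-1)\to e(i)$ (and $p=e(0)$ if $l=0$), let $p_i=\gamma_i\cdots\gamma_1$ for $0\le i\le l$ be its right subpaths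 (so $p_0=e(0)$), let $A_p\subseteq\Lambda e$ be the $K$-subspace spanned by the residue classes of $p_0,\dots,p_l$, and let $\mathcal G\text{-Uni}(p)$ be the set of all $m$-dimensional $\Lambda$-submodules $C$ of $\Lambda e$ with $\Lambda e=A_p\oplus C$. Then every member of $\mathcal G\text{-Uni}(\mathbb S)$ has $K$-dimension $m$. View $\mathcal G\text{-Uni}(\mathbb S)$ and the sets $\mathcal G\text{-Uni}(p)$ as subsets of the Grassmannian of $m$-dimensional subspaces of $\Lambda e$, embedded in $\mathbb P(\bigwedge^m\Lambda e)$ by the Plücker embedding. Then: 1. $\mathcal G\text{-Uni}(\mathbb S)$ is a quasi-projective variety, i.e. it is locally closed in $\mathbb P(\bigwedge^m\Lambda e)$ for the Zariski topology (varieties need not be irreducible, and may be empty). 2. $\mathcal G\text{-Uni}(\mathbb S)=\bigcup_p\mathcal G\text{-Uni}(p)$, where $p$ ranges over the paths in $K\Gamma\setminus I$ through $\mathbb S$. 3. For every such $p$, $\mathcal G\text{-Uni}(p)$ is an affine variety, i.e. isomorphic to a Zariski closed subset of some affine space $K^n$, and it is a principal open subset of $\mathcal G\text{-Uni}(\mathbb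 S)$, i.e. the set of the points of $\mathcal G\text{-Uni}(\mathbb S)$ at which some homogeneous form of positive degree on $\mathbb P(\bigwedge^m\Lambda e)$ does not vanish. -/

import Mathlib

open scoped LinearAlgebra.Projectivization Topology

noncomputable section

/-! ### Path algebras of quivers -/

universe u v w

/-- A path of the quiver `Q`, together with its starting and end vertex. -/
structure QuiverPath (Q : Type u) [Quiver.{v} Q] where
  /-- the starting vertex -/
  src : Q
  /-- the end vertex -/
  tgt : Q
  /-- the path -/
  path : Quiver.Path src tgt

/-- The underlying `K`-vector space of the path algebra `KQ`: it has the paths of `Q`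
(including one path of length zero at every vertex) as a basis. -/
def PathAlgebra (K : Type w) (Q : Type u) [Field K] [Quiver.{v} Q] : Type (max u v w) :=
  QuiverPath Q →₀ K

namespace PathAlgebra

variable {K : Type w} {Q : Type u} [Field K] [Quiver.{v} Q]

instance : AddCommGroup (PathAlgebra K Q) := inferInstanceAs (AddCommGroup (QuiverPath Q →₀ K))

instance : Module K (PathAlgebra K Q) := inferInstanceAs (Module K (QuiverPath Q →₀ K))

variable (K Q) in
/-- The paths of the quiver form a basis of the path algebra. -/
def basis : Module.Basis (QuiverPath Q) K (PathAlgebra K Q) :=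
  ⟨LinearEquiv.refl K (QuiverPath Q →₀ K)⟩

variable (K) in
/-- The basis element of the path algebra given by a path. -/
def single (p : QuiverPath Q) : PathAlgebra K Q := basis K Q p

variable (K) in
/-- The basis element of the path algebra given by a path from `a` to `b`. -/
def ofPath {a b : Q} (p : Quiver.Path a b) : PathAlgebra K Q := single K ⟨a, b, p⟩

/-- The coefficient of a path in an element of the path algebra. -/
def coeff (x : PathAlgebra K Q) (p : QuiverPath Q) : K := (basis K Q).repr x p

open Classical in
variable (K) in
/-- The product `q p` of two paths: "`q` after `p`" if `q` starts where `p` ends, and `0`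
otherwise. -/
def mulPath (q p : QuiverPath Q) : PathAlgebra K Q :=
  if h : p.tgt = q.src then single K ⟨p.src, q.tgt, (p.path.cast rfl h).comp q.path⟩ else 0

lemma mulPath_comp {a b c : Q} (q : Quiver.Path b c) (p : Quiver.Path a b) :
    mulPath K ⟨b, c, q⟩ ⟨a, b, p⟩ = ofPath K (p.comp q) := by
  simp [mulPath, ofPath]

lemma mulPath_of_ne {q p : QuiverPath Q} (h : p.tgt ≠ q.src) : mulPath K q p = 0 := by
  simp [mulPath, h]

variable (K Q) in
/-- The bilinear extension of the product of paths. -/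
def mulHom : PathAlgebra K Q →ₗ[K] PathAlgebra K Q →ₗ[K] PathAlgebra K Q :=
  (basis K Q).constr K fun q => (basis K Q).constr K fun p => mulPath K q p

lemma mulHom_single (q p : QuiverPath Q) :
    mulHom K Q (single K q) (single K p) = mulPath K q p := by
  rw [mulHom, single, single, Module.Basis.constr_basis, Module.Basis.constr_basis]

lemma hom_ext {M : Type*} [AddCommGroup M] [Module K M] {f g : PathAlgebra K Q →ₗ[K] M}
    (h : ∀ p, f (single K p) = g (single K p)) : f = g :=
  (basis K Q).ext h

instance : Mul (PathAlgebra K Q) := ⟨fun x y => mulHom K Q x y⟩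

lemma mul_def (x y : PathAlgebra K Q) : x * y = mulHom K Q x y := rfl

lemma mul_assoc_single (r q p : QuiverPath Q) :
    single K r * single K q * single K p = single K r * (single K q * single K p) := by
  obtain ⟨c, d, r⟩ := r
  obtain ⟨b, c', q⟩ := q
  obtain ⟨a, b', p⟩ := p
  simp only [mul_def, mulHom_single]
  by_cases h₁ : c' = c
  · subst h₁
    by_cases h₂ : b' = b
    · subst h₂
      simp only [mulPath_comp, ofPath, mulHom_single, Quiver.Path.comp_assoc]
    · rw [mulPath_of_ne (p := ⟨a, b', p⟩) h₂, mulPath_comp, ofPath, mulHom_single,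
        mulPath_of_ne (p := ⟨a, b', p⟩) h₂, map_zero]
  · rw [mulPath_of_ne (q := ⟨c, d, r⟩) h₁, map_zero, LinearMap.zero_apply]
    by_cases h₂ : b' = b
    · subst h₂
      rw [mulPath_comp, ofPath, mulHom_single, mulPath_of_ne (q := ⟨c, d, r⟩) h₁]
    · rw [mulPath_of_ne (p := ⟨a, b', p⟩) h₂, map_zero]

/-- The unit element of the path algebra is the sum of the paths of length zero. -/
instance [Fintype Q] : One (PathAlgebra K Q) :=
  ⟨∑ a : Q, ofPath K (Quiver.Path.nil : Quiver.Path a a)⟩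

lemma one_def [Fintype Q] :
    (1 : PathAlgebra K Q) = ∑ a : Q, ofPath K (Quiver.Path.nil : Quiver.Path a a) := rfl

instance [Fintype Q] : Ring (PathAlgebra K Q) where
  __ : AddCommGroup (PathAlgebra K Q) := inferInstance
  left_distrib x y z := by simp [mul_def]
  right_distrib x y z := by simp [mul_def]
  zero_mul x := by simp [mul_def]
  mul_zero x := by simp [mul_def]
  mul_assoc x y z := by
    have h : (mulHom K Q).compr₂ (mulHom K Q) =
        (LinearMap.llcomp K _ _ _).flip (mulHom K Q) ∘ₗ
          (LinearMap.llcomp K (PathAlgebra K Q) (PathAlgebra K Q) (PathAlgebra K Q)) ∘ₗ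
            (mulHom K Q) := by
      refine hom_ext fun r => hom_ext fun q => hom_ext fun p => ?_
      exact mul_assoc_single r q p
    exact congrArg (fun f => f x y z) h
  one_mul x := by
    have h : mulHom K Q 1 = LinearMap.id := by
      refine hom_ext fun p => ?_
      obtain ⟨a, b, p⟩ := p
      simp only [one_def, map_sum, LinearMap.sum_apply, LinearMap.id_apply, ofPath, mulHom_single]
      rw [Finset.sum_eq_single b (fun c _ hc => mulPath_of_ne (Ne.symm hc)) (by simp),
        mulPath_comp, ofPath, Quiver.Path.comp_nil]
    exact congrArg (fun f => f x) h
  mul_one x := by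
    have h : (mulHom K Q).flip 1 = LinearMap.id := by
      refine hom_ext fun p => ?_
      obtain ⟨a, b, p⟩ := p
      simp only [one_def, map_sum, LinearMap.sum_apply, LinearMap.id_apply, ofPath,
        LinearMap.flip_apply, mulHom_single]
      rw [Finset.sum_eq_single a (fun c _ hc => mulPath_of_ne hc) (by simp),
        mulPath_comp, ofPath, Quiver.Path.nil_comp]
    exact congrArg (fun f => f x) h

instance [Fintype Q] : Algebra K (PathAlgebra K Q) :=
  Algebra.ofModule (fun r x y => by simp [mul_def]) (fun r x y => by simp [mul_def])

/-- An ideal `I` of the path algebra `KQ` is a *relation ideal* if it is contained in the ideal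
generated by the arrows and contains all paths of length at least `N`, for some `N`.  (Every
admissible ideal is of this kind.) -/
def IsRelationIdeal [Fintype Q] (I : Ideal (PathAlgebra K Q)) : Prop :=
  (∀ x ∈ I, ∀ a : Q, coeff x ⟨a, a, Quiver.Path.nil⟩ = 0) ∧
    ∃ N : ℕ, ∀ p : QuiverPath Q, N ≤ p.path.length → single K p ∈ I

end PathAlgebra

/-! ### Uniserial modules over `Λ = KQ / I` -/

section Uniserial

variable {K : Type w} {Q : Type u} [Field K] [Quiver.{v} Q] [Fintype Q]
variable (I : Ideal (PathAlgebra K Q)) [I.IsTwoSided]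

/-- The residue class in `Λ = KQ / I` of a path. -/
def pathClass {a b : Q} (p : Quiver.Path a b) : PathAlgebra K Q ⧸ I :=
  Ideal.Quotient.mk I (PathAlgebra.ofPath K p)

/-- The idempotent of `Λ = KQ / I` given by a vertex. -/
def vertexIdem (a : Q) : PathAlgebra K Q ⧸ I := pathClass I (Quiver.Path.nil : Quiver.Path a a)

/-- The left ideal `Λ e` of `Λ = KQ / I`, where `e` is the idempotent of the vertex `a`. -/
abbrev projLeft (a : Q) : Submodule (PathAlgebra K Q ⧸ I) (PathAlgebra K Q ⧸ I) :=
  Ideal.span {vertexIdem I a}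

/-- The left ideal `J e = {x e | x ∈ J}`, where `J` is the Jacobson radical of `Λ = KQ / I`
and `e` is the idempotent of the vertex `a`. -/
def radLeft (a : Q) : Submodule (PathAlgebra K Q ⧸ I) (PathAlgebra K Q ⧸ I) :=
  Submodule.map (LinearMap.toSpanSingleton _ _ (vertexIdem I a))
    (Ring.jacobson (PathAlgebra K Q ⧸ I))

/-- The simple left module `Λ e / J e` of a vertex. -/
abbrev vertexSimple (a : Q) : Type _ := projLeft I a ⧸ (radLeft I a).submoduleOf (projLeft I a)

variable {l : ℕ}

/-- The left `Λ`-module `U` is uniserial with composition series `(S(0), …, S(l))`, where `S(i)`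
is the simple module of the vertex `e i`: the submodules of `U` form a chain, and there is a
series `U = U₀ ⊇ U₁ ⊇ ⋯ ⊇ U_{l+1} = 0` of submodules with `Uᵢ / Uᵢ₊₁ ≅ S(i)`. -/
def IsUniserialWithSeries (e : Fin (l + 1) → Q) (U : Type*) [AddCommGroup U]
    [Module (PathAlgebra K Q ⧸ I) U] : Prop :=
  (∀ A B : Submodule (PathAlgebra K Q ⧸ I) U, A ≤ B ∨ B ≤ A) ∧
    ∃ c : Fin (l + 2) → Submodule (PathAlgebra K Q ⧸ I) U,
      c 0 = ⊤ ∧ c (Fin.last (l + 1)) = ⊥ ∧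
      ∀ i : Fin (l + 1), c i.succ ≤ c i.castSucc ∧
        Nonempty ((c i.castSucc ⧸ (c i.succ).submoduleOf (c i.castSucc))
          ≃ₗ[PathAlgebra K Q ⧸ I] vertexSimple I (e i))

/-- A path `p = γ_l ⋯ γ_1` passing through the vertices `e 0, …, e l` in this sequence, given by
its arrows `e (i - 1) ⟶ e i`. -/
abbrev PathThrough (e : Fin (l + 1) → Q) : Type v := ∀ i : Fin l, e i.castSucc ⟶ e i.succ

/-- The right subpath `p_i` of length `i` of a path `p` through `e 0, …, e l`. -/
def PathThrough.rightSub {e : Fin (l + 1) → Q} (p : PathThrough e) :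
    ∀ i : Fin (l + 1), Quiver.Path (e 0) (e i) :=
  Fin.induction Quiver.Path.nil (fun i q => q.cons (p i))

/-- The path `p` itself. -/
abbrev PathThrough.toPath {e : Fin (l + 1) → Q} (p : PathThrough e) :
    Quiver.Path (e 0) (e (Fin.last l)) := p.rightSub (Fin.last l)

lemma pathClass_mem {a b : Q} (p : Quiver.Path a b) : pathClass I p ∈ projLeft I a := by
  refine Ideal.mem_span_singleton'.2 ⟨pathClass I p, ?_⟩
  rw [vertexIdem, pathClass, pathClass, ← map_mul, PathAlgebra.ofPath, PathAlgebra.ofPath,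
    PathAlgebra.mul_def, PathAlgebra.mulHom_single, PathAlgebra.mulPath_comp,
    Quiver.Path.nil_comp, PathAlgebra.ofPath]

/-- The subspace `A_p` of `Λ e`, `e = e 0`, spanned by the right subpaths of `p`. -/
def subpathSpan {e : Fin (l + 1) → Q} (p : PathThrough e) : Submodule K (projLeft I (e 0)) :=
  Submodule.span K (Set.range fun i => ⟨pathClass I (p.rightSub i), pathClass_mem I _⟩)

/-- `m = dim Λ e - (l + 1)` -/
def uniDim (e : Fin (l + 1) → Q) : ℕ := Module.finrank K (projLeft I (e 0)) - (l + 1)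

/-- The set of the submodules `C` of `Λ e`, `e = e 0`, such that `Λ e / C` is uniserial with
composition series `(S(0), …, S(l))`. -/
def GUni (e : Fin (l + 1) → Q) : Set (Submodule (PathAlgebra K Q ⧸ I) (projLeft I (e 0))) :=
  {C | IsUniserialWithSeries I e (projLeft I (e 0) ⧸ C)}

/-- The set of the `m`-dimensional submodules `C` of `Λ e` which complement the subspace `A_p`. -/
def GUniPath {e : Fin (l + 1) → Q} (p : PathThrough e) :
    Set (Submodule (PathAlgebra K Q ⧸ I) (projLeft I (e 0))) :=
  {C | Module.finrank K C = uniDim I e ∧ IsCompl (subpathSpan I p) (C.restrictScalars K)}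

end Uniserial

/-! ### Classical algebraic geometry in the projective space of a vector space -/

section Variety

variable {K : Type*} [Field K] {V : Type*} [AddCommGroup V] [Module K V]

/-- The value of a homogeneous form `F` (a homogeneous polynomial in linear forms on `V`) at the
chosen representative of a point of `ℙ(V)`.  Only its vanishing, and the quotient of two such
values of forms of the same degree, are used; they do not depend on the representative. -/
def formEval (F : MvPolynomial (Module.Dual K V) K) (x : ℙ K V) : K :=
  MvPolynomial.eval (fun φ => φ x.rep) F

variable (K V) in
/-- The Zariski topology of `ℙ(V)`: the non-vanishing loci of homogeneous forms are a basis. -/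
@[reducible] def projZariski : TopologicalSpace (ℙ K V) :=
  TopologicalSpace.generateFrom
    {U | ∃ (d : ℕ) (F : MvPolynomial (Module.Dual K V) K), F.IsHomogeneous d ∧
      U = {x | formEval F x ≠ 0}}

variable (K) in
/-- The Zariski topology of affine `n`-space. -/
@[reducible] def affZariski (n : ℕ) : TopologicalSpace (Fin n → K) :=
  TopologicalSpace.generateFrom
    {U | ∃ f : MvPolynomial (Fin n) K, U = {x | MvPolynomial.eval x f ≠ 0}}

/-- A subset of `ℙ(V)` is a quasi-projective variety (not necessarily irreducible) if it is
locally closed for the Zariski topology. -/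
def IsQuasiProjective (X : Set (ℙ K V)) : Prop := @IsLocallyClosed _ (projZariski K V) X

/-- `f : X → K` is regular at the point `x` of `X ⊆ ℙ(V)`: near `x` it is a quotient of two
homogeneous forms of the same degree, with nowhere vanishing denominator. -/
def ProjRegularAt (X : Set (ℙ K V)) (f : X → K) (x : X) : Prop :=
  ∃ U : Set (ℙ K V), IsOpen[projZariski K V] U ∧ (x : ℙ K V) ∈ U ∧
    ∃ (d : ℕ) (F G : MvPolynomial (Module.Dual K V) K), F.IsHomogeneous d ∧ G.IsHomogeneous d ∧
      ∀ y : X, (y : ℙ K V) ∈ U → formEval G y ≠ 0 ∧ f y = formEval F y / formEval G y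

/-- `f : Z → K` is regular at the point `z` of `Z ⊆ Kⁿ`: near `z` it is a quotient of two
polynomials, with nowhere vanishing denominator. -/
def AffRegularAt {n : ℕ} (Z : Set (Fin n → K)) (f : Z → K) (z : Z) : Prop :=
  ∃ U : Set (Fin n → K), IsOpen[affZariski K n] U ∧ (z : Fin n → K) ∈ U ∧
    ∃ F G : MvPolynomial (Fin n) K, ∀ y : Z, (y : Fin n → K) ∈ U →
      MvPolynomial.eval (y : Fin n → K) G ≠ 0 ∧
        f y = MvPolynomial.eval (y : Fin n → K) F / MvPolynomial.eval (y : Fin n → K) G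

/-- The subvariety `X` of `ℙ(V)` is affine: it is isomorphic to a Zariski closed subset `Z` of
some affine space, that is, there is a homeomorphism `X ≃ Z` under which the regular functions on
open subsets of `Z` and of `X` correspond to each other.  (A function on an open set `U` is
regular iff it is so at all points of `U`, so it suffices to compare regularity at points.) -/
def IsAffineVariety (X : Set (ℙ K V)) : Prop :=
  ∃ (n : ℕ) (𝔞 : Ideal (MvPolynomial (Fin n) K)) (φ : X ≃ MvPolynomial.zeroLocus K 𝔞),
    (∀ U : Set (MvPolynomial.zeroLocus K 𝔞),
      IsOpen[(affZariski K n).induced Subtype.val] U ↔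
        IsOpen[(projZariski K V).induced Subtype.val] (φ ⁻¹' U)) ∧
    ∀ (f : MvPolynomial.zeroLocus K 𝔞 → K) (x : X),
      AffRegularAt (MvPolynomial.zeroLocus K 𝔞) f (φ x) ↔ ProjRegularAt X (f ∘ φ) x

/-- `Y` is a principal open subset of the variety `X ⊆ ℙ(V)`: the set of the points of `X` where
some homogeneous form of positive degree does not vanish. -/
def IsPrincipalOpen (X Y : Set (ℙ K V)) : Prop :=
  ∃ (d : ℕ) (F : MvPolynomial (Module.Dual K V) K), 0 < d ∧ F.IsHomogeneous d ∧
    Y = {x ∈ X | formEval F x ≠ 0}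

end Variety

/-! ### Grassmannians in their Plücker embedding -/

section Grassmannian

variable (K : Type*) [Field K] (V : Type*) [AddCommGroup V] [Module K V]

/-- The Grassmannian of the `m`-dimensional subspaces of `V`. -/
abbrev SubspaceGrassmannian (m : ℕ) : Type _ := {W : Submodule K V // Module.finrank K W = m}

variable {K V} [FiniteDimensional K V]

lemma finrank_range_exteriorPower {m : ℕ} (W : SubspaceGrassmannian K V m) :
    Module.finrank K (LinearMap.range (exteriorPower.map m W.1.subtype)) = 1 := by
  rw [LinearMap.finrank_range_of_inj
    (exteriorPower.map_injective_field W.1.injective_subtype),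
    exteriorPower.finrank_eq, W.2, Nat.choose_self]

/-- The Plücker embedding, which takes `W` to the line `⋀ᵐ W` in `⋀ᵐ V`. -/
def plucker {m : ℕ} (W : SubspaceGrassmannian K V m) : ℙ K (⋀[K]^m V) :=
  Projectivization.mk'' (LinearMap.range (exteriorPower.map m W.1.subtype))
    (finrank_range_exteriorPower W)

/-- The Plücker embedding is injective, so that sets of subspaces can be identified with their
images in projective space. -/
lemma plucker_injective {m : ℕ} :
    Function.Injective (plucker : SubspaceGrassmannian K V m → ℙ K (⋀[K]^m V)) := by
  suffices h : ∀ W W' : SubspaceGrassmannian K V m, plucker W = plucker W' → W'.1 ≤ W.1 from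
    fun W W' e => Subtype.ext (le_antisymm (h W' W e.symm) (h W W' e))
  intro W W' e w' hw'
  by_contra hw
  have hr : LinearMap.range (exteriorPower.map m W.1.subtype) =
      LinearMap.range (exteriorPower.map m W'.1.subtype) := by
    have := congrArg Projectivization.submodule e
    rwa [plucker, plucker, Projectivization.submodule_mk'', Projectivization.submodule_mk''] at this
  have hw0 : w' ≠ 0 := fun h0 => hw (h0 ▸ W.1.zero_mem)
  have hd : Disjoint (Submodule.span K {w'}) W.1 :=
    ((Submodule.disjoint_span_singleton' hw0).2 hw).symm
  obtain ⟨N, hN, hc⟩ := hd.exists_isCompl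
  have hwN : w' ∈ N := hN (Submodule.mem_span_singleton_self w')
  set π : V →ₗ[K] W.1 := W.1.projectionOnto N hc.symm with hπ
  have h1 : π ∘ₗ W.1.subtype = LinearMap.id :=
    LinearMap.ext fun x => Submodule.projectionOnto_apply_left hc.symm x
  set g : W'.1 →ₗ[K] W.1 := π ∘ₗ W'.1.subtype with hg
  have hg0 : g ⟨w', hw'⟩ = 0 :=
    (Submodule.projectionOnto_apply_eq_zero_iff hc.symm).2 hwN
  have hlt : Module.finrank K (LinearMap.range g) < m := by
    have h2 := LinearMap.finrank_range_add_finrank_ker g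
    have h3 : 0 < Module.finrank K (LinearMap.ker g) := by
      rw [Module.finrank_pos_iff_exists_ne_zero]
      exact ⟨⟨⟨w', hw'⟩, hg0⟩, fun h => hw0 (congrArg (fun z => (z.1.1 : V)) h)⟩
    rw [W'.2] at h2
    omega
  have hz : exteriorPower.map m g = 0 := by
    have hf : g = (LinearMap.range g).subtype ∘ₗ g.rangeRestrict := rfl
    have hs : Subsingleton (⋀[K]^m (LinearMap.range g)) := by
      rw [← Module.finrank_zero_iff (R := K), exteriorPower.finrank_eq, Nat.choose_eq_zero_iff]
      exact hlt
    rw [hf, exteriorPower.map_comp]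
    ext x
    simp [Subsingleton.elim (exteriorPower.map m g.rangeRestrict _) 0]
  have hone : ∀ x, exteriorPower.map m W.1.subtype x = 0 := by
    intro x
    obtain ⟨y, hy⟩ : exteriorPower.map m W.1.subtype x ∈
        LinearMap.range (exteriorPower.map m W'.1.subtype) := hr ▸ LinearMap.mem_range_self _ x
    have e1 : exteriorPower.map m π (exteriorPower.map m W.1.subtype x) = x := by
      rw [← LinearMap.comp_apply, ← exteriorPower.map_comp, h1, exteriorPower.map_id]; rfl
    have e2 : exteriorPower.map m π (exteriorPower.map m W'.1.subtype y) = 0 := by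
      rw [← LinearMap.comp_apply, ← exteriorPower.map_comp, ← hg, hz]; rfl
    rw [hy, e1] at e2
    rw [e2, map_zero]
  have hfin := finrank_range_exteriorPower W
  rw [LinearMap.range_eq_bot.2 (LinearMap.ext hone), finrank_bot] at hfin
  exact zero_ne_one hfin

end Grassmannian

section UniserialVariety

variable {K : Type w} {Q : Type u} [Field K] [Quiver.{v} Q] [Fintype Q]
variable (I : Ideal (PathAlgebra K Q)) [I.IsTwoSided]

instance [FiniteDimensional K (PathAlgebra K Q ⧸ I)] (a : Q) :
    FiniteDimensional K (projLeft I a) :=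
  inferInstanceAs (FiniteDimensional K ((projLeft I a).restrictScalars K))

/-- A set `X` of submodules of `Λ e`, viewed in the Grassmannian of `m`-dimensional subspaces of
`Λ e`, which is embedded into projective space by the Plücker embedding. -/
def pluckerImage [FiniteDimensional K (PathAlgebra K Q ⧸ I)] {a : Q} (m : ℕ)
    (X : Set (Submodule (PathAlgebra K Q ⧸ I) (projLeft I a))) :
    Set (ℙ K (⋀[K]^m (projLeft I a))) :=
  {x | ∃ C ∈ X, ∃ h : Module.finrank K (C.restrictScalars K) = m,
    plucker ⟨C.restrictScalars K, h⟩ = x}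

end UniserialVariety

end

/-!
A submodule `C` of `Λ e` for which `Λ e / C` is uniserial with the factors `S(0), …, S(l)` is
detected by a path.  In one direction, the radical takes each term of the composition series of
`Λ e / C` into the next one, so that an element of a term which generates it modulo the next term
must be moved, by one single arrow, to a generator of the next term (`exists_arrow_of_factors`).
Composing these arrows gives a path `p` through `e 0, …, e l` whose right subpaths `pᵢ` represent a
basis of `Λ e / C`, that is, `Λ e = A_p ⊕ C` (`exists_path_of_isUniserialWithSeries`).  Conversely,
if `p ∉ I` and `Λ e = A_p ⊕ C`, the classes `xᵢ` of the `pᵢ` in the module `Λ e / C`, which has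
dimension at most `l + 1`, are nonzero and `Λ xᵢ₊₁` lies in the radical of `Λ xᵢ`.  By Nakayama's
lemma the chain of the `Λ xᵢ` is strictly decreasing, so for reasons of dimension it is the radical
series and has one-dimensional factors (`isUniserialWithSeries_of_path`).

Being complementary to `A_p` is the nonvanishing of one Plücker coordinate, the linear form `G₀` of
an affine chart.  In it a complement of `A_p` is the graph of a matrix `z`; the entries of `z` are
quotients of linear forms by `G₀`, while the Plücker coordinates of the graph are polynomials in `z`.
Stability under `Λ` is a system of polynomial equations for `z` (`exists_affineChart_isCompl`).
Therefore the set given by `p` is isomorphic to a Zariski closed subset of an affine space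
(`AffineChart.isAffineVariety_image`), it is the principal open subset `G₀ ≠ 0` of the whole
variety, and it is closed in the open subset `G₀ ≠ 0` of the projective space
(`AffineChart.isOpen_domain_diff_image`).  As these open subsets cover the variety, it is locally
closed; no equations for the Grassmannian itself are needed.
-/

universe u v w

/-! ### Affine charts of projective space -/

section AffineChart

variable {K : Type*} [Field K] {W : Type*} [AddCommGroup W] [Module K W] {n : ℕ}

lemma eval_dual_smul {F : MvPolynomial (Module.Dual K W) K} {d : ℕ} (hF : F.IsHomogeneous d)
    (a : K) (w : W) :
    MvPolynomial.eval (fun ψ : Module.Dual K W => ψ (a • w)) F =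
      a ^ d * MvPolynomial.eval (fun ψ : Module.Dual K W => ψ w) F := by
  rw [MvPolynomial.eval_eq, MvPolynomial.eval_eq, Finset.mul_sum]
  refine Finset.sum_congr rfl fun s hs => ?_
  simp only [map_smul, smul_eq_mul, mul_pow, Finset.prod_mul_distrib, Finset.prod_pow_eq_pow_sum]
  rw [← hF.degree_eq_sum_deg_support hs]
  ring

/-- Up to a nonzero factor, depending only on the degree, the value of a form at a point of
`ℙ(W)` may be computed from any representative of the point. -/
lemma exists_formEval_mk (w : W) (hw : w ≠ 0) :
    ∃ a : K, a ≠ 0 ∧ ∀ (F : MvPolynomial (Module.Dual K W) K) (d : ℕ), F.IsHomogeneous d →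
      formEval F (Projectivization.mk K w hw) =
        a ^ d * MvPolynomial.eval (fun ψ : Module.Dual K W => ψ w) F := by
  obtain ⟨a, ha⟩ := Projectivization.exists_smul_eq_mk_rep K w hw
  refine ⟨a, a.ne_zero, fun F d hF => ?_⟩
  rw [formEval, ← ha, ← eval_dual_smul hF]
  rfl

/-- The homogenization, of degree `N`, of a polynomial `f` along linear forms: the variables are
replaced by `G i / G₀`, and the result is multiplied by `G₀ ^ N`. -/
noncomputable def homogenization (G₀ : Module.Dual K W) (G : Fin n → Module.Dual K W) (N : ℕ)
    (f : MvPolynomial (Fin n) K) : MvPolynomial (Module.Dual K W) K :=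
  ∑ s ∈ f.support, MvPolynomial.C (f.coeff s) *
    (MvPolynomial.X G₀ ^ (N - ∑ i, s i) * ∏ i, MvPolynomial.X (G i) ^ s i)

lemma sum_le_totalDegree {f : MvPolynomial (Fin n) K} {s : Fin n →₀ ℕ} (hs : s ∈ f.support) :
    ∑ i, s i ≤ f.totalDegree := by
  have := MvPolynomial.le_totalDegree hs
  rwa [Finsupp.sum_fintype _ _ (fun _ => rfl)] at this

lemma isHomogeneous_homogenization (G₀ : Module.Dual K W) (G : Fin n → Module.Dual K W) {N : ℕ}
    {f : MvPolynomial (Fin n) K} (hf : f.totalDegree ≤ N) :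
    (homogenization G₀ G N f).IsHomogeneous N := by
  refine MvPolynomial.IsHomogeneous.sum _ _ _ fun s hs => ?_
  have hs' := (sum_le_totalDegree hs).trans hf
  have h := (MvPolynomial.isHomogeneous_C (Module.Dual K W) (f.coeff s)).mul
    (((MvPolynomial.isHomogeneous_X K G₀).pow (N - ∑ i, s i)).mul
      (MvPolynomial.IsHomogeneous.prod Finset.univ (fun i => MvPolynomial.X (R := K) (G i) ^ s i)
        (fun i => 1 * s i) fun i _ => (MvPolynomial.isHomogeneous_X K (G i)).pow (s i)))
  convert h using 1
  simp only [one_mul, zero_add]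
  omega

lemma formEval_homogenization (G₀ : Module.Dual K W) (G : Fin n → Module.Dual K W) {N : ℕ}
    {f : MvPolynomial (Fin n) K} (hf : f.totalDegree ≤ N) {x : ℙ K W} (hx : G₀ x.rep ≠ 0) :
    formEval (homogenization G₀ G N f) x =
      G₀ x.rep ^ N * MvPolynomial.eval (fun i => G i x.rep / G₀ x.rep) f := by
  rw [formEval, homogenization, map_sum, MvPolynomial.eval_eq', Finset.mul_sum]
  refine Finset.sum_congr rfl fun s hs => ?_
  have hs' := (sum_le_totalDegree hs).trans hf
  simp only [map_mul, map_pow, map_prod, MvPolynomial.eval_C, MvPolynomial.eval_X, div_pow,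
    Finset.prod_div_distrib, Finset.prod_pow_eq_pow_sum]
  rw [← Nat.sub_add_cancel hs', pow_add, Nat.add_sub_cancel]
  field_simp

variable (K W n) in
/-- An affine space `Kⁿ` embedded in the affine chart `G₀ ≠ 0` of `ℙ(W)` as a graph: the point `z`
is taken to the line through `vec z`, where `vec` is a polynomial map, and `z` is recovered from
its image by means of the linear forms `G i`. -/
structure AffineChart where
  /-- the linear form defining the chart -/
  G₀ : Module.Dual K W
  /-- the linear forms that give the coordinates -/
  G : Fin n → Module.Dual K W
  /-- the embedding, on the level of representatives -/
  vec : (Fin n → K) → W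
  exists_poly : ∀ ψ : Module.Dual K W, ∃ P : MvPolynomial (Fin n) K,
    ∀ z, ψ (vec z) = MvPolynomial.eval z P
  G₀_vec : ∀ z, G₀ (vec z) = 1
  G_vec : ∀ z i, G i (vec z) = z i

namespace AffineChart

variable (c : AffineChart K W n)

lemma vec_ne_zero (z : Fin n → K) : c.vec z ≠ 0 := fun h => by
  simpa [h] using c.G₀_vec z

/-- The point of `ℙ(W)` with the coordinates `z`. -/
noncomputable def point (z : Fin n → K) : ℙ K W := Projectivization.mk K (c.vec z) (c.vec_ne_zero z)

/-- The coordinates of a point of `ℙ(W)`; they are meaningful only where `G₀` does not vanish. -/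
noncomputable def coord (x : ℙ K W) : Fin n → K := fun i => c.G i x.rep / c.G₀ x.rep

/-- The open subset `G₀ ≠ 0` of `ℙ(W)`. -/
def domain : Set (ℙ K W) := {x | formEval (MvPolynomial.X c.G₀) x ≠ 0}

lemma mem_domain {x : ℙ K W} : x ∈ c.domain ↔ c.G₀ x.rep ≠ 0 := by
  simp [domain, formEval]

lemma exists_point_rep (z : Fin n → K) : ∃ a : Kˣ, (c.point z).rep = a • c.vec z := by
  obtain ⟨a, ha⟩ := Projectivization.exists_smul_eq_mk_rep K (c.vec z) (c.vec_ne_zero z)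
  exact ⟨a, ha.symm⟩

lemma point_mem_domain (z : Fin n → K) : c.point z ∈ c.domain := by
  obtain ⟨a, ha⟩ := c.exists_point_rep z
  rw [mem_domain, ha, Units.smul_def, map_smul, c.G₀_vec]
  simp

lemma coord_point (z : Fin n → K) : c.coord (c.point z) = z := by
  obtain ⟨a, ha⟩ := c.exists_point_rep z
  funext i
  rw [coord, ha, Units.smul_def, map_smul, map_smul, c.G₀_vec, c.G_vec]
  simp

lemma isOpen_domain : IsOpen[projZariski K W] c.domain :=
  TopologicalSpace.isOpen_generateFrom_of_mem
    ⟨1, MvPolynomial.X c.G₀, MvPolynomial.isHomogeneous_X K c.G₀, rfl⟩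

/-- The polynomial functions which represent the linear forms on `W` on the chart. -/
noncomputable def poly (ψ : Module.Dual K W) : MvPolynomial (Fin n) K := (c.exists_poly ψ).choose

lemma eval_poly (z : Fin n → K) (ψ : Module.Dual K W) :
    MvPolynomial.eval z (c.poly ψ) = ψ (c.vec z) :=
  ((c.exists_poly ψ).choose_spec z).symm

lemma eval_aeval_poly (z : Fin n → K) (F : MvPolynomial (Module.Dual K W) K) :
    MvPolynomial.eval z (MvPolynomial.aeval c.poly F) =
      MvPolynomial.eval (fun ψ : Module.Dual K W => ψ (c.vec z)) F := by
  induction F using MvPolynomial.induction_on with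
  | C a => simp
  | add p q hp hq => simp only [map_add, hp, hq]
  | mul_X p i hp => simp only [map_mul, hp, MvPolynomial.aeval_X, MvPolynomial.eval_X, eval_poly]

lemma isOpen_setOf_eval_coord_ne (f : MvPolynomial (Fin n) K) :
    IsOpen[projZariski K W] {x | x ∈ c.domain ∧ MvPolynomial.eval (c.coord x) f ≠ 0} := by
  refine TopologicalSpace.isOpen_generateFrom_of_mem ⟨1 + f.totalDegree,
    MvPolynomial.X c.G₀ * homogenization c.G₀ c.G f.totalDegree f,
    (MvPolynomial.isHomogeneous_X K c.G₀).mul (isHomogeneous_homogenization _ _ le_rfl), ?_⟩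
  ext x
  have hmul : formEval (MvPolynomial.X c.G₀ * homogenization c.G₀ c.G f.totalDegree f) x =
      c.G₀ x.rep * formEval (homogenization c.G₀ c.G f.totalDegree f) x := by
    simp [formEval]
  rw [Set.mem_ofPred_eq, Set.mem_ofPred_eq, hmul, mem_domain]
  by_cases hx : c.G₀ x.rep = 0
  · simp [hx]
  · rw [formEval_homogenization _ _ le_rfl hx]
    simp only [ne_eq, mul_eq_zero, hx, pow_eq_zero_iff', false_and, false_or, not_false_eq_true,
      true_and]
    rfl

lemma isOpen_preimage_coord {U : Set (Fin n → K)} (hU : IsOpen[affZariski K n] U) :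
    IsOpen[projZariski K W] {x | x ∈ c.domain ∧ c.coord x ∈ U} := by
  let _ := projZariski K W
  induction hU with
  | basic s hs =>
    obtain ⟨f, rfl⟩ := hs
    exact c.isOpen_setOf_eval_coord_ne f
  | univ => simpa using c.isOpen_domain
  | inter s t _ _ hs ht =>
    convert hs.inter ht using 1
    ext x
    simp only [Set.mem_ofPred_eq, Set.mem_inter_iff]
    tauto
  | sUnion S _ hS =>
    convert isOpen_biUnion hS using 1
    ext x
    simp only [Set.mem_ofPred_eq, Set.mem_sUnion, Set.mem_iUnion]
    tauto

lemma isOpen_preimage_point {U : Set (ℙ K W)} (hU : IsOpen[projZariski K W] U) :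
    IsOpen[affZariski K n] (c.point ⁻¹' U) := by
  let _ := affZariski K n
  let _ := projZariski K W
  suffices h : Continuous c.point from hU.preimage h
  refine continuous_generateFrom_iff.2 ?_
  rintro _ ⟨d, F, hF, rfl⟩
  refine TopologicalSpace.isOpen_generateFrom_of_mem ⟨MvPolynomial.aeval c.poly F, ?_⟩
  ext z
  obtain ⟨a, ha, h⟩ := exists_formEval_mk (K := K) (c.vec z) (c.vec_ne_zero z)
  simp only [Set.mem_preimage, Set.mem_ofPred_eq, point, h F d hF, eval_aeval_poly]
  simp [ha]

/-- The part of an affine chart over a Zariski closed subset of `Kⁿ` is an affine variety. -/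
theorem isAffineVariety_image (𝔞 : Ideal (MvPolynomial (Fin n) K)) :
    IsAffineVariety (c.point '' MvPolynomial.zeroLocus K 𝔞) := by
  let φ : c.point '' MvPolynomial.zeroLocus K 𝔞 ≃ MvPolynomial.zeroLocus K 𝔞 :=
    { toFun := fun x => ⟨c.coord x, by
        obtain ⟨z, hz, hx⟩ := x.2
        rw [← hx, c.coord_point]
        exact hz⟩
      invFun := fun z => ⟨c.point z, z, z.2, rfl⟩
      left_inv := by
        rintro ⟨_, z, hz, rfl⟩
        exact Subtype.ext (congrArg c.point (c.coord_point z))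
      right_inv := fun z => Subtype.ext (c.coord_point z) }
  have hdom : ∀ x : c.point '' MvPolynomial.zeroLocus K 𝔞, (x : ℙ K W) ∈ c.domain := by
    rintro ⟨_, z, hz, rfl⟩
    exact c.point_mem_domain z
  have hpt : ∀ x : c.point '' MvPolynomial.zeroLocus K 𝔞, c.point (φ x) = x := fun x =>
    congrArg Subtype.val (φ.symm_apply_apply x)
  refine ⟨n, 𝔞, φ, fun U => ⟨fun hU => ?_, fun hU => ?_⟩, fun f x => ⟨fun hf => ?_, fun hf => ?_⟩⟩
  · let _ := affZariski K n
    let _ := projZariski K W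
    obtain ⟨O, hO, rfl⟩ := isOpen_induced_iff.1 hU
    refine isOpen_induced_iff.2 ⟨_, c.isOpen_preimage_coord hO, ?_⟩
    ext x
    exact ⟨fun h => h.2, fun h => ⟨hdom x, h⟩⟩
  · let _ := affZariski K n
    let _ := projZariski K W
    obtain ⟨O, hO, h⟩ := isOpen_induced_iff.1 hU
    refine isOpen_induced_iff.2 ⟨_, c.isOpen_preimage_point hO, ?_⟩
    ext z
    have := Set.ext_iff.1 h (φ.symm z)
    rw [Set.mem_preimage, Set.mem_preimage, Equiv.apply_symm_apply] at this
    exact this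
  · obtain ⟨U, hU, hxU, F, G, h⟩ := hf
    have hF := le_max_left F.totalDegree G.totalDegree
    have hG := le_max_right F.totalDegree G.totalDegree
    refine ⟨_, c.isOpen_preimage_coord hU, ⟨hdom x, hxU⟩, _, _, _,
      isHomogeneous_homogenization c.G₀ c.G hF, isHomogeneous_homogenization c.G₀ c.G hG,
      fun y hy => ?_⟩
    obtain ⟨h1, h2⟩ := h (φ y) hy.2
    have h0 := c.mem_domain.1 hy.1
    rw [formEval_homogenization _ _ hF h0, formEval_homogenization _ _ hG h0]
    refine ⟨mul_ne_zero (pow_ne_zero _ h0) h1, ?_⟩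
    rw [mul_div_mul_left _ _ (pow_ne_zero _ h0)]
    exact h2
  · obtain ⟨U, hU, hxU, d, F, G, hF, hG, h⟩ := hf
    refine ⟨_, c.isOpen_preimage_point hU, ?_, MvPolynomial.aeval c.poly F,
      MvPolynomial.aeval c.poly G, fun z hz => ?_⟩
    · rw [Set.mem_preimage, hpt]
      exact hxU
    · obtain ⟨h1, h2⟩ := h (φ.symm z) hz
      obtain ⟨a, ha, h3⟩ := exists_formEval_mk (K := K) (c.vec z) (c.vec_ne_zero z)
      have hF' : formEval F (φ.symm z : ℙ K W) = _ := h3 F d hF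
      have hG' : formEval G (φ.symm z : ℙ K W) = _ := h3 G d hG
      rw [hG'] at h1
      rw [Function.comp_apply, Equiv.apply_symm_apply, hF', hG',
        mul_div_mul_left _ _ (pow_ne_zero _ ha)] at h2
      rw [eval_aeval_poly, eval_aeval_poly]
      exact ⟨right_ne_zero_of_mul h1, h2⟩

/-- The part of an affine chart over a Zariski closed subset of `Kⁿ` is closed in the open subset
`G₀ ≠ 0` of the projective space. -/
theorem isOpen_domain_diff_image (𝔞 : Ideal (MvPolynomial (Fin n) K)) :
    IsOpen[projZariski K W] (c.domain \ c.point '' MvPolynomial.zeroLocus K 𝔞) := by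
  let _ := projZariski K W
  -- `x` is outside the image iff its coordinates violate an equation of `𝔞`, or if some linear
  -- form separates the representative of `x` from the corresponding multiple of `vec (coord x)`
  have h : c.domain \ c.point '' MvPolynomial.zeroLocus K 𝔞 =
      (⋃ f ∈ 𝔞, {x | x ∈ c.domain ∧ MvPolynomial.eval (c.coord x) f ≠ 0}) ∪
      ⋃ ψ : Module.Dual K W, c.domain ∩ {x | formEval (MvPolynomial.X c.G₀ *
        (homogenization c.G₀ c.G (c.poly ψ).totalDegree (c.poly ψ)) -
          MvPolynomial.X ψ * MvPolynomial.X c.G₀ ^ (c.poly ψ).totalDegree) x ≠ 0} := by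
    ext x
    simp only [Set.mem_sdiff, Set.mem_union, Set.mem_iUnion, Set.mem_ofPred_eq, Set.mem_inter_iff]
    by_cases hx : x ∈ c.domain
    swap
    · simp [hx]
    simp only [hx, true_and]
    have h0 := c.mem_domain.1 hx
    have key : ∀ ψ : Module.Dual K W, formEval (MvPolynomial.X c.G₀ *
        (homogenization c.G₀ c.G (c.poly ψ).totalDegree (c.poly ψ)) -
          MvPolynomial.X ψ * MvPolynomial.X c.G₀ ^ (c.poly ψ).totalDegree) x =
        c.G₀ x.rep ^ (c.poly ψ).totalDegree *
          ψ (c.G₀ x.rep • c.vec (c.coord x) - x.rep) := by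
      intro ψ
      have h1 := formEval_homogenization c.G₀ c.G (le_refl (c.poly ψ).totalDegree) h0
      have h2 := c.eval_poly (c.coord x) ψ
      rw [formEval] at h1
      rw [formEval, map_sub, map_mul, h1, map_mul, map_pow, MvPolynomial.eval_X,
        MvPolynomial.eval_X, map_sub, map_smul, ← h2, smul_eq_mul]
      change _ = _ * (_ * MvPolynomial.eval (fun i => c.G i x.rep / c.G₀ x.rep) _ - _)
      ring
    simp only [key]
    constructor
    · intro hxi
      by_contra! hcon
      refine hxi ⟨c.coord x, fun f hf => ?_, ?_⟩
      · exact hcon.1 f hf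
      · have h1 : c.G₀ x.rep • c.vec (c.coord x) - x.rep = 0 := by
          rw [← Module.forall_dual_apply_eq_zero_iff K]
          intro ψ
          exact (mul_eq_zero.1 (hcon.2 ψ)).resolve_left (pow_ne_zero _ h0)
        conv_rhs => rw [← x.mk_rep]
        rw [point, Projectivization.mk_eq_mk_iff']
        exact ⟨(c.G₀ x.rep)⁻¹, (inv_smul_eq_iff₀ h0).2 (sub_eq_zero.1 h1).symm⟩
    · rintro h ⟨z, hz, rfl⟩
      rcases h with ⟨f, hf, hne⟩ | ⟨ψ, hne⟩
      · rw [c.coord_point] at hne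
        exact hne (hz f hf)
      · refine hne ?_
        obtain ⟨a, ha⟩ := c.exists_point_rep z
        rw [c.coord_point, ha, Units.smul_def, map_smul, c.G₀_vec, smul_eq_mul, mul_one, sub_self,
          map_zero, mul_zero]
  rw [h]
  refine (isOpen_biUnion fun f _ => c.isOpen_setOf_eval_coord_ne f).union
    (isOpen_iUnion fun ψ => c.isOpen_domain.inter
      (TopologicalSpace.isOpen_generateFrom_of_mem ⟨1 + (c.poly ψ).totalDegree, _, ?_, rfl⟩))
  refine ((MvPolynomial.isHomogeneous_X K c.G₀).mul
    (isHomogeneous_homogenization _ _ le_rfl)).sub ?_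
  simpa using (MvPolynomial.isHomogeneous_X K ψ).mul
    ((MvPolynomial.isHomogeneous_X K c.G₀).pow (c.poly ψ).totalDegree)

end AffineChart

end AffineChart

/-! ### Affine charts of Grassmannians -/

section GrassmannianChart

/-- A function on `Kⁿ` is polynomial if it is given by a polynomial. -/
def IsPolyFun {K : Type*} [Field K] {n : ℕ} (f : (Fin n → K) → K) : Prop :=
  ∃ P : MvPolynomial (Fin n) K, ∀ z, f z = MvPolynomial.eval z P

namespace IsPolyFun

variable {K : Type*} [Field K] {n : ℕ} {f g : (Fin n → K) → K}

lemma const (a : K) : IsPolyFun (n := n) fun _ => a := ⟨MvPolynomial.C a, by simp⟩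

lemma coord (i : Fin n) : IsPolyFun (K := K) fun z => z i := ⟨MvPolynomial.X i, by simp⟩

lemma add (hf : IsPolyFun f) (hg : IsPolyFun g) : IsPolyFun fun z => f z + g z := by
  obtain ⟨P, hP⟩ := hf
  obtain ⟨R, hR⟩ := hg
  exact ⟨P + R, by simp [hP, hR]⟩

lemma sub (hf : IsPolyFun f) (hg : IsPolyFun g) : IsPolyFun fun z => f z - g z := by
  obtain ⟨P, hP⟩ := hf
  obtain ⟨R, hR⟩ := hg
  exact ⟨P - R, by simp [hP, hR]⟩

lemma mul (hf : IsPolyFun f) (hg : IsPolyFun g) : IsPolyFun fun z => f z * g z := by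
  obtain ⟨P, hP⟩ := hf
  obtain ⟨R, hR⟩ := hg
  exact ⟨P * R, by simp [hP, hR]⟩

lemma sum {ι : Type*} (s : Finset ι) {f : ι → (Fin n → K) → K} (hf : ∀ i, IsPolyFun (f i)) :
    IsPolyFun fun z => ∑ i ∈ s, f i z := by
  choose P hP using hf
  exact ⟨∑ i ∈ s, P i, by simp [hP]⟩

lemma prod {ι : Type*} (s : Finset ι) {f : ι → (Fin n → K) → K} (hf : ∀ i, IsPolyFun (f i)) :
    IsPolyFun fun z => ∏ i ∈ s, f i z := by
  choose P hP using hf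
  exact ⟨∏ i ∈ s, P i, by simp [hP]⟩

end IsPolyFun

variable {K : Type*} [Field K] {V : Type*} [AddCommGroup V] [Module K V] {m k : ℕ}

/-- The linear form on `⋀ᵐ V` given by a linear map `g : V → Kᵐ`, which takes `w₁ ∧ ⋯ ∧ wₘ` to the
determinant with the rows `g w₁, …, g wₘ`. -/
noncomputable def detForm (g : V →ₗ[K] Fin m → K) : Module.Dual K (⋀[K]^m V) :=
  exteriorPower.alternatingMapLinearEquiv (Matrix.detRowAlternating.compLinearMap g)

lemma detForm_ιMulti (g : V →ₗ[K] Fin m → K) (w : Fin m → V) :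
    detForm g (exteriorPower.ιMulti K m w) = Matrix.det (Matrix.of fun j => g (w j)) := by
  rw [detForm, exteriorPower.alternatingMapLinearEquiv_apply_ιMulti]
  rfl

/-- A left inverse of the map `Kᵐ → V` given by `w` yields a linear form with value `1` at
`w₁ ∧ ⋯ ∧ wₘ`. -/
lemma ιMulti_ne_zero {w : Fin m → V} (hw : LinearIndependent K w) :
    exteriorPower.ιMulti K m w ≠ 0 := by
  obtain ⟨g, hg⟩ := (Fintype.linearCombination K w).exists_leftInverse_of_injective
    (LinearMap.ker_eq_bot.2 (linearIndependent_iff_injective_fintypeLinearCombination.1 hw))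
  intro h
  have h1 := detForm_ιMulti g w
  have h2 : (Matrix.of fun j => g (w j)) = 1 := by
    ext i j
    have := LinearMap.congr_fun hg (Pi.single i 1)
    rw [LinearMap.comp_apply, Fintype.linearCombination_apply_single, one_smul] at this
    rw [Matrix.of_apply, this, LinearMap.id_apply, Matrix.one_apply, Pi.single_apply]
    simp only [eq_comm]
  rw [h2, Matrix.det_one, h, map_zero] at h1
  exact zero_ne_one h1

lemma plucker_eq_mk [FiniteDimensional K V] (W : SubspaceGrassmannian K V m) {w : Fin m → V}
    (hw : LinearIndependent K w) (hW : ∀ j, w j ∈ W.1) :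
    plucker W = Projectivization.mk K (exteriorPower.ιMulti K m w) (ιMulti_ne_zero hw) := by
  apply Projectivization.submodule_injective
  rw [plucker, Projectivization.submodule_mk'', Projectivization.submodule_mk]
  refine (Submodule.eq_of_le_of_finrank_eq ?_ ?_).symm
  · rw [Submodule.span_singleton_le_iff_mem]
    exact ⟨exteriorPower.ιMulti K m fun j => ⟨w j, hW j⟩,
      exteriorPower.map_apply_ιMulti W.1.subtype _⟩
  · rw [finrank_range_exteriorPower, finrank_span_singleton (ιMulti_ne_zero hw)]

/-- Coordinates `(y, x) : V ≃ Kᵐ × Kᵏ` describe the subspaces complementary to `{y = 0}` as the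
graphs of matrices `z`; these are the vectors that span the graph of `z`. -/
def graphVec (Φ : V ≃ₗ[K] (Fin m → K) × (Fin k → K)) (z : Fin (m * k) → K) (j : Fin m) : V :=
  Φ.symm (Pi.single j 1, fun i => z (finProdFinEquiv (j, i)))

/-- The first component of a system of coordinates `V ≃ Kᵐ × Kᵏ`. -/
def fstCoord (Φ : V ≃ₗ[K] (Fin m → K) × (Fin k → K)) : V →ₗ[K] Fin m → K :=
  LinearMap.fst K _ _ ∘ₗ Φ.toLinearMap

/-- The linear map `V → Kᵐ` given by the first coordinates, with the `j`-th of them replaced by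
the `i`-th one of the second coordinates. -/
def exchangeCoord (Φ : V ≃ₗ[K] (Fin m → K) × (Fin k → K)) (j : Fin m) (i : Fin k) :
    V →ₗ[K] Fin m → K :=
  LinearMap.pi fun s => if s = j then LinearMap.proj i ∘ₗ LinearMap.snd K _ _ ∘ₗ Φ.toLinearMap
    else LinearMap.proj s ∘ₗ fstCoord Φ

variable (Φ : V ≃ₗ[K] (Fin m → K) × (Fin k → K))

lemma fstCoord_graphVec (z : Fin (m * k) → K) (j : Fin m) :
    fstCoord Φ (graphVec Φ z j) = Pi.single j 1 := by
  simp [fstCoord, graphVec]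

lemma detForm_fstCoord_graphVec (z : Fin (m * k) → K) :
    detForm (fstCoord Φ) (exteriorPower.ιMulti K m (graphVec Φ z)) = 1 := by
  rw [detForm_ιMulti]
  convert Matrix.det_one (R := K) (n := Fin m)
  ext i j
  rw [Matrix.of_apply, fstCoord_graphVec, Matrix.one_apply, Pi.single_apply]
  simp only [eq_comm]

lemma detForm_exchangeCoord_graphVec (z : Fin (m * k) → K) (j : Fin m) (i : Fin k) :
    detForm (exchangeCoord Φ j i) (exteriorPower.ιMulti K m (graphVec Φ z)) =
      z (finProdFinEquiv (j, i)) := by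
  have h : (Matrix.of fun r => exchangeCoord Φ j i (graphVec Φ z r)) =
      (1 : Matrix (Fin m) (Fin m) K).updateCol j fun r => z (finProdFinEquiv (r, i)) := by
    ext r s
    rw [Matrix.of_apply, Matrix.updateCol_apply, exchangeCoord, LinearMap.pi_apply]
    split_ifs with hs
    · simp [graphVec]
    · rw [LinearMap.comp_apply, fstCoord_graphVec, LinearMap.proj_apply, Matrix.one_apply,
        Pi.single_apply]
      simp only [eq_comm]
  rw [detForm_ιMulti, h, ← Matrix.cramer_apply, Matrix.cramer_one]
  rfl

lemma isPolyFun_graphVec (ψ : Module.Dual K V) (j : Fin m) :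
    IsPolyFun fun z => ψ (graphVec Φ z j) := by
  have h : ∀ z, ψ (graphVec Φ z j) = ψ (Φ.symm (Pi.single j 1, 0)) +
      ∑ i, z (finProdFinEquiv (j, i)) * ψ (Φ.symm (0, Pi.single i 1)) := by
    intro z
    have h1 : ((Pi.single j 1, fun i => z (finProdFinEquiv (j, i))) :
        (Fin m → K) × (Fin k → K)) = (Pi.single j 1, 0) +
          ∑ i, z (finProdFinEquiv (j, i)) • ((0, Pi.single i 1) : (Fin m → K) × (Fin k → K)) := by
      refine Prod.ext ?_ ?_
      · simp [Prod.fst_sum]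
      · funext i
        simp [Prod.snd_sum, Finset.sum_apply, Pi.single_apply]
    simp only [graphVec, h1, map_add, map_sum, map_smul, smul_eq_mul]
  simp only [h]
  exact (IsPolyFun.const _).add (IsPolyFun.sum _ fun i => (IsPolyFun.coord _).mul
    (IsPolyFun.const _))

lemma isPolyFun_ιMulti_graphVec [FiniteDimensional K V] (ψ : Module.Dual K (⋀[K]^m V)) :
    IsPolyFun fun z => ψ (exteriorPower.ιMulti K m (graphVec Φ z)) := by
  let b := Module.finBasis K V
  let g : MultilinearMap K (fun _ : Fin m => V) K :=
    (ψ.compAlternatingMap (exteriorPower.ιMulti K m)).toMultilinearMap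
  have h : ∀ z, ψ (exteriorPower.ιMulti K m (graphVec Φ z)) =
      ∑ r : Fin m → Fin (Module.finrank K V), (∏ j, b.coord (r j) (graphVec Φ z j)) *
        g fun j => b (r j) := by
    intro z
    have h1 : graphVec Φ z = fun j => ∑ t, b.coord t (graphVec Φ z j) • b t := by
      funext j
      exact (b.sum_repr _).symm
    change g (graphVec Φ z) = _
    conv_lhs => rw [h1]
    rw [MultilinearMap.map_sum]
    refine Finset.sum_congr rfl fun r _ => ?_
    rw [MultilinearMap.map_smul_univ, smul_eq_mul]
  simp only [h]
  exact IsPolyFun.sum _ fun r => (IsPolyFun.prod _ fun j => isPolyFun_graphVec Φ _ j).mul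
    (IsPolyFun.const _)

/-- The chart of the projective space of `⋀ᵐ V` around the subspaces complementary to
`{y = 0}`, for a system of coordinates `(y, x) : V ≃ Kᵐ × Kᵏ`. -/
noncomputable def grassmannianChart [FiniteDimensional K V] :
    AffineChart K (⋀[K]^m V) (m * k) where
  G₀ := detForm (fstCoord Φ)
  G s := detForm (exchangeCoord Φ (finProdFinEquiv.symm s).1 (finProdFinEquiv.symm s).2)
  vec z := exteriorPower.ιMulti K m (graphVec Φ z)
  exists_poly := isPolyFun_ιMulti_graphVec Φ
  G₀_vec := detForm_fstCoord_graphVec Φ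
  G_vec z s := by
    rw [detForm_exchangeCoord_graphVec, Prod.mk.eta, Equiv.apply_symm_apply]

/-- The graph of the matrix `z`, in the coordinates `V ≃ Kᵐ × Kᵏ`. -/
def graphSubspace (z : Fin (m * k) → K) : Submodule K V :=
  Submodule.span K (Set.range (graphVec Φ z))

lemma linearIndependent_graphVec (z : Fin (m * k) → K) : LinearIndependent K (graphVec Φ z) := by
  refine LinearIndependent.of_comp (fstCoord Φ) ?_
  have h : fstCoord Φ ∘ graphVec Φ z = Pi.basisFun K (Fin m) := by
    funext j
    rw [Function.comp_apply, fstCoord_graphVec, Pi.basisFun_apply]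
  rw [h]
  exact (Pi.basisFun K (Fin m)).linearIndependent

lemma finrank_graphSubspace (z : Fin (m * k) → K) :
    Module.finrank K (graphSubspace Φ z) = m := by
  rw [graphSubspace, finrank_span_eq_card (linearIndependent_graphVec Φ z), Fintype.card_fin]

lemma mem_graphSubspace_iff {z : Fin (m * k) → K} {x : V} :
    x ∈ graphSubspace Φ z ↔
      ∀ i, (Φ x).2 i = ∑ j, (Φ x).1 j * z (finProdFinEquiv (j, i)) := by
  rw [graphSubspace, Submodule.mem_span_range_iff_exists_fun]
  have h : ∀ y : Fin m → K, Φ (∑ j, y j • graphVec Φ z j) =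
      (y, fun i => ∑ j, y j * z (finProdFinEquiv (j, i))) := by
    intro y
    simp only [map_sum, map_smul, graphVec, LinearEquiv.apply_symm_apply]
    refine Prod.ext ?_ ?_
    · funext i
      simp [Prod.fst_sum, Finset.sum_apply, Pi.single_apply]
    · funext i
      simp [Prod.snd_sum, Finset.sum_apply]
  constructor
  · rintro ⟨y, rfl⟩ i
    rw [h]
  · intro hx
    refine ⟨(Φ x).1, Φ.injective ?_⟩
    rw [h]
    exact Prod.ext rfl (funext fun i => (hx i).symm)

lemma plucker_graphSubspace [FiniteDimensional K V] (z : Fin (m * k) → K) :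
    plucker ⟨graphSubspace Φ z, finrank_graphSubspace Φ z⟩ = (grassmannianChart Φ).point z :=
  plucker_eq_mk _ (linearIndependent_graphVec Φ z) fun j => Submodule.subset_span ⟨j, rfl⟩

lemma finrank_ker_fstCoord [FiniteDimensional K V] :
    Module.finrank K V = Module.finrank K (LinearMap.ker (fstCoord Φ)) + m := by
  have h1 := LinearMap.finrank_range_add_finrank_ker (fstCoord Φ)
  have h2 : LinearMap.range (fstCoord Φ) = ⊤ := by
    rw [LinearMap.range_eq_top]
    intro y
    exact ⟨Φ.symm (y, 0), by simp [fstCoord]⟩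
  rw [h2, finrank_top, Module.finrank_fin_fun] at h1
  omega

lemma isCompl_ker_fstCoord_iff [FiniteDimensional K V] (W : SubspaceGrassmannian K V m) :
    IsCompl (LinearMap.ker (fstCoord Φ)) W.1 ↔
      Function.Injective (fstCoord Φ ∘ₗ W.1.subtype) := by
  rw [Submodule.isCompl_iff_disjoint _ _ (by rw [W.2]; exact (finrank_ker_fstCoord Φ).le),
    ← LinearMap.ker_eq_bot, LinearMap.ker_comp, ← Submodule.disjoint_iff_comap_eq_bot,
    disjoint_comm]

lemma plucker_mem_domain_iff [FiniteDimensional K V] (W : SubspaceGrassmannian K V m) :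
    plucker W ∈ (grassmannianChart Φ).domain ↔ IsCompl (LinearMap.ker (fstCoord Φ)) W.1 := by
  let b := Module.finBasisOfFinrankEq K W.1 W.2
  have hw : LinearIndependent K fun j => (b j : V) :=
    b.linearIndependent.map' W.1.subtype W.1.ker_subtype
  have h1 : plucker W ∈ (grassmannianChart Φ).domain ↔
      IsUnit (Matrix.det (Matrix.of fun j => fstCoord Φ (b j))) := by
    rw [plucker_eq_mk W hw fun j => (b j).2, isUnit_iff_ne_zero, ← detForm_ιMulti]
    obtain ⟨a, ha, h⟩ := exists_formEval_mk (K := K) _ (ιMulti_ne_zero hw)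
    have h2 := h _ _ (MvPolynomial.isHomogeneous_X K (grassmannianChart Φ).G₀)
    rw [AffineChart.domain, Set.mem_ofPred_eq, h2, MvPolynomial.eval_X]
    simp [ha, grassmannianChart]
  rw [h1, isCompl_ker_fstCoord_iff, ← Matrix.isUnit_iff_isUnit_det,
    ← Matrix.linearIndependent_rows_iff_isUnit]
  have h3 : (Matrix.of fun j => fstCoord Φ (b j)).row =
      (fstCoord Φ ∘ₗ W.1.subtype) ∘ b := rfl
  rw [h3]
  constructor
  · intro h
    rw [linearIndependent_iff_injective_fintypeLinearCombination] at h
    intro x y hxy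
    refine b.equivFun.injective (h ?_)
    have : ∀ x, Fintype.linearCombination K ((fstCoord Φ ∘ₗ W.1.subtype) ∘ b) (b.equivFun x) =
        (fstCoord Φ ∘ₗ W.1.subtype) x := by
      intro x
      conv_rhs => rw [← b.sum_equivFun x]
      rw [Fintype.linearCombination_apply, map_sum]
      simp only [map_smul, Function.comp_apply]
    rw [this, this, hxy]
  · intro h
    exact b.linearIndependent.map' _ (LinearMap.ker_eq_bot.2 h)

lemma exists_eq_graphSubspace [FiniteDimensional K V] (W : SubspaceGrassmannian K V m)
    (hW : IsCompl (LinearMap.ker (fstCoord Φ)) W.1) : ∃ z, W.1 = graphSubspace Φ z := by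
  let g := LinearEquiv.ofInjectiveOfFinrankEq (fstCoord Φ ∘ₗ W.1.subtype)
    ((isCompl_ker_fstCoord_iff Φ W).1 hW) (by rw [W.2, Module.finrank_fin_fun])
  have hg : ∀ y, fstCoord Φ (g.symm y) = y := fun y => g.apply_symm_apply y
  let z : Fin (m * k) → K := fun s =>
    (Φ (g.symm (Pi.single (finProdFinEquiv.symm s).1 1))).2 (finProdFinEquiv.symm s).2
  refine ⟨z, (Submodule.eq_of_le_of_finrank_eq (Submodule.span_le.2 ?_)
    (by rw [W.2]; exact finrank_graphSubspace Φ z)).symm⟩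
  rintro _ ⟨j, rfl⟩
  have h : graphVec Φ z j = g.symm (Pi.single j 1) := by
    rw [graphVec, LinearEquiv.symm_apply_eq]
    refine Prod.ext (hg _).symm ?_
    funext i
    change (Φ (g.symm (Pi.single (finProdFinEquiv.symm (finProdFinEquiv (j, i))).1 1))).2
      (finProdFinEquiv.symm (finProdFinEquiv (j, i))).2 = _
    rw [Equiv.symm_apply_apply]
  rw [h]
  exact (g.symm (Pi.single j 1)).2

/-- The subspaces of `V` which are stable under given endomorphisms and complementary to
`{y = 0}` correspond to a Zariski closed subset of the affine space of matrices. -/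
lemma exists_image_zeroLocus_eq [FiniteDimensional K V] {ι : Type*} (T : ι → V →ₗ[K] V) :
    ∃ 𝔞 : Ideal (MvPolynomial (Fin (m * k)) K),
      (grassmannianChart Φ).point '' MvPolynomial.zeroLocus K 𝔞 =
        {x | ∃ W : SubspaceGrassmannian K V m, IsCompl (LinearMap.ker (fstCoord Φ)) W.1 ∧
          (∀ t, ∀ w ∈ W.1, T t w ∈ W.1) ∧ plucker W = x} := by
  let Z : Set (Fin (m * k) → K) := {z | ∀ t, ∀ w ∈ graphSubspace Φ z, T t w ∈ graphSubspace Φ z}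
  have hpoly : ∀ t j i, IsPolyFun fun z => (Φ (T t (graphVec Φ z j))).2 i -
      ∑ s, (Φ (T t (graphVec Φ z j))).1 s * z (finProdFinEquiv (s, i)) := fun t j i =>
    (isPolyFun_graphVec Φ
      (LinearMap.proj i ∘ₗ LinearMap.snd K _ _ ∘ₗ Φ.toLinearMap ∘ₗ T t) j).sub
      (IsPolyFun.sum _ fun s => (isPolyFun_graphVec Φ
        (LinearMap.proj s ∘ₗ LinearMap.fst K _ _ ∘ₗ Φ.toLinearMap ∘ₗ T t) j).mul
        (IsPolyFun.coord _))
  have hZ : MvPolynomial.zeroLocus K (MvPolynomial.vanishingIdeal K Z) = Z := by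
    refine subset_antisymm (fun z hz => ?_) (MvPolynomial.zeroLocus_vanishingIdeal_le Z)
    intro t
    refine fun w hw => (Submodule.span_le (p := (graphSubspace Φ z).comap (T t))).2 ?_ hw
    rintro _ ⟨j, rfl⟩
    refine (mem_graphSubspace_iff Φ).2 fun i => ?_
    obtain ⟨P, hP⟩ := hpoly t j i
    refine sub_eq_zero.1 ((hP z).trans (hz P fun y hy => ?_))
    refine (hP y).symm.trans (sub_eq_zero.2 ?_)
    exact (mem_graphSubspace_iff Φ).1 (hy t _ (Submodule.subset_span ⟨j, rfl⟩)) i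
  refine ⟨MvPolynomial.vanishingIdeal K Z, ?_⟩
  rw [hZ]
  ext x
  constructor
  · rintro ⟨z, hz, rfl⟩
    refine ⟨⟨graphSubspace Φ z, finrank_graphSubspace Φ z⟩, ?_, hz, plucker_graphSubspace Φ z⟩
    rw [← plucker_mem_domain_iff, plucker_graphSubspace]
    exact AffineChart.point_mem_domain _ z
  · rintro ⟨W, hW, hT, rfl⟩
    obtain ⟨z, hz⟩ := exists_eq_graphSubspace Φ W hW
    refine ⟨z, ?_, ?_⟩
    · change ∀ t, ∀ w ∈ graphSubspace Φ z, T t w ∈ graphSubspace Φ z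
      rw [← hz]
      exact hT
    · rw [← plucker_graphSubspace]
      exact congrArg plucker (Subtype.ext hz.symm)

lemma exists_ker_fstCoord_eq [FiniteDimensional K V] {A : Submodule K V}
    (hA : Module.finrank K A + m = Module.finrank K V) :
    ∃ Φ : V ≃ₗ[K] (Fin m → K) × (Fin (Module.finrank K A) → K),
      LinearMap.ker (fstCoord Φ) = A := by
  obtain ⟨C, hC⟩ := A.exists_isCompl
  have hCm : Module.finrank K C = m := by
    have := Submodule.finrank_add_eq_of_isCompl hC
    omega
  let Φ := (Submodule.prodEquivOfIsCompl C A hC.symm).symm.trans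
    (LinearEquiv.prodCongr (Module.finBasisOfFinrankEq K C hCm).equivFun
      (Module.finBasis K A).equivFun)
  refine ⟨Φ, ?_⟩
  ext x
  have h : fstCoord Φ x = (Module.finBasisOfFinrankEq K C hCm).equivFun
      ((Submodule.prodEquivOfIsCompl C A hC.symm).symm x).1 := rfl
  rw [LinearMap.mem_ker, h, LinearEquiv.map_eq_zero_iff,
    Submodule.prodEquivOfIsCompl_symm_apply_fst_eq_zero]

/-- The subspaces complementary to `A` are those in an affine chart of the projective space
of `⋀ᵐ V`, and the ones which moreover are stable under given endomorphisms of `V` form the part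
of that chart over a Zariski closed subset of affine space. -/
theorem exists_affineChart_isCompl [FiniteDimensional K V] {A : Submodule K V}
    (hA : Module.finrank K A + m = Module.finrank K V) {ι : Type*} (T : ι → V →ₗ[K] V) :
    ∃ (n : ℕ) (c : AffineChart K (⋀[K]^m V) n) (𝔞 : Ideal (MvPolynomial (Fin n) K)),
      (∀ W : SubspaceGrassmannian K V m, plucker W ∈ c.domain ↔ IsCompl A W.1) ∧
      c.point '' MvPolynomial.zeroLocus K 𝔞 =
        {x | ∃ W : SubspaceGrassmannian K V m, IsCompl A W.1 ∧
          (∀ t, ∀ w ∈ W.1, T t w ∈ W.1) ∧ plucker W = x} := by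
  obtain ⟨Φ, hΦ⟩ := exists_ker_fstCoord_eq hA
  obtain ⟨𝔞, h𝔞⟩ := exists_image_zeroLocus_eq Φ T
  have h := plucker_mem_domain_iff Φ
  rw [hΦ] at h𝔞 h
  exact ⟨_, grassmannianChart Φ, 𝔞, h, h𝔞⟩

end GrassmannianChart

/-! ### Paths in the quotient `Λ = KQ / I`, and the Jacobson radical -/

section PathClass

variable {K : Type w} {Q : Type u} [Field K] [Quiver.{v} Q] [Fintype Q]
variable (I : Ideal (PathAlgebra K Q)) [I.IsTwoSided]

lemma pathClass_mul {a b c : Q} (q : Quiver.Path b c) (p : Quiver.Path a b) :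
    pathClass I q * pathClass I p = pathClass I (p.comp q) := by
  rw [pathClass, pathClass, ← map_mul, PathAlgebra.ofPath, PathAlgebra.ofPath,
    PathAlgebra.mul_def, PathAlgebra.mulHom_single, PathAlgebra.mulPath_comp]
  rfl

lemma pathClass_mul_of_ne {a b b' c : Q} (q : Quiver.Path b' c) (p : Quiver.Path a b)
    (h : b ≠ b') : pathClass I q * pathClass I p = 0 := by
  rw [pathClass, pathClass, ← map_mul, PathAlgebra.ofPath, PathAlgebra.ofPath,
    PathAlgebra.mul_def, PathAlgebra.mulHom_single, PathAlgebra.mulPath_of_ne h, map_zero]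

lemma vertexIdem_mul_pathClass {a b : Q} (p : Quiver.Path a b) :
    vertexIdem I b * pathClass I p = pathClass I p := by
  rw [vertexIdem, pathClass_mul, Quiver.Path.comp_nil]

lemma pathClass_mul_vertexIdem {a b : Q} (p : Quiver.Path a b) :
    pathClass I p * vertexIdem I a = pathClass I p := by
  rw [vertexIdem, pathClass_mul, Quiver.Path.nil_comp]

lemma vertexIdem_mul_self (a : Q) : vertexIdem I a * vertexIdem I a = vertexIdem I a :=
  vertexIdem_mul_pathClass I _

lemma vertexIdem_mul_of_ne {a b : Q} (h : a ≠ b) : vertexIdem I b * vertexIdem I a = 0 :=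
  pathClass_mul_of_ne I _ _ h

/-- The span of the residue classes of the paths of length at least `n`. -/
noncomputable def longPathSpan (n : ℕ) : Submodule K (PathAlgebra K Q ⧸ I) :=
  Submodule.span K {x | ∃ p : QuiverPath Q, n ≤ p.path.length ∧ pathClass I p.path = x}

lemma longPathSpan_zero : longPathSpan I 0 = ⊤ := by
  rw [eq_top_iff]
  rintro x -
  obtain ⟨x, rfl⟩ := Ideal.Quotient.mk_surjective x
  have hx : x ∈ Submodule.span K (Set.range (PathAlgebra.basis K Q)) := by
    rw [Module.Basis.span_eq]
    trivial
  induction hx using Submodule.span_induction with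
  | mem x hx =>
    obtain ⟨p, rfl⟩ := hx
    exact Submodule.subset_span ⟨p, Nat.zero_le _, rfl⟩
  | zero => rw [map_zero]; exact zero_mem _
  | add x y _ _ hx hy => rw [map_add]; exact add_mem hx hy
  | smul a x _ hx => exact Submodule.smul_mem _ a hx

/-- Induction on the elements of `Λ`, which are linear combinations of paths. -/
lemma pathClass_induction {P : PathAlgebra K Q ⧸ I → Prop} (zero : P 0)
    (add : ∀ x y, P x → P y → P (x + y)) (smul : ∀ (k : K) x, P x → P (k • x))
    (path : ∀ (a b : Q) (p : Quiver.Path a b), P (pathClass I p)) (x : PathAlgebra K Q ⧸ I) :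
    P x := by
  have hx : x ∈ longPathSpan I 0 := by rw [longPathSpan_zero]; trivial
  induction hx using Submodule.span_induction with
  | mem x hx =>
    obtain ⟨p, -, rfl⟩ := hx
    exact path _ _ _
  | zero => exact zero
  | add x y _ _ hx hy => exact add x y hx hy
  | smul a x _ hx => exact smul a x hx

lemma mul_mem_longPathSpan {m n : ℕ} {x y : PathAlgebra K Q ⧸ I} (hx : x ∈ longPathSpan I m)
    (hy : y ∈ longPathSpan I n) : x * y ∈ longPathSpan I (m + n) := by
  classical
  have h : longPathSpan I m * longPathSpan I n ≤ longPathSpan I (m + n) := by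
    rw [longPathSpan, longPathSpan, Submodule.span_mul_span, Submodule.span_le]
    rintro _ ⟨_, ⟨⟨b', c, q⟩, hq, rfl⟩, _, ⟨⟨a, b, p⟩, hp, rfl⟩, rfl⟩
    by_cases h : b = b'
    · subst h
      refine Submodule.subset_span ⟨⟨a, c, p.comp q⟩, ?_, (pathClass_mul I q p).symm⟩
      simp only [Quiver.Path.length_comp] at hp hq ⊢
      omega
    · change pathClass I q * pathClass I p ∈ longPathSpan I (m + n)
      rw [pathClass_mul_of_ne I q p h]
      exact zero_mem _
  exact h (Submodule.mul_mem_mul hx hy)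

variable {I}

lemma vertexIdem_ne_zero (hI : PathAlgebra.IsRelationIdeal I) (a : Q) : vertexIdem I a ≠ 0 := by
  intro h
  have h1 := hI.1 _ (Ideal.Quotient.eq_zero_iff_mem.1 h) a
  rw [PathAlgebra.ofPath, PathAlgebra.single, PathAlgebra.coeff, Module.Basis.repr_self,
    Finsupp.single_eq_same] at h1
  exact one_ne_zero h1

/-- Paths of positive length lie in the radical, since they generate a nil left ideal. -/
lemma pathClass_mem_jacobson (hI : PathAlgebra.IsRelationIdeal I) {a b : Q} (p : Quiver.Path a b)
    (hp : 1 ≤ p.length) : pathClass I p ∈ Ring.jacobson (PathAlgebra K Q ⧸ I) := by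
  rw [← Ideal.jacobson_bot, Ideal.mem_jacobson_iff]
  intro y
  obtain ⟨N, hN⟩ := hI.2
  have h1 : y * pathClass I p ∈ longPathSpan I 1 := by
    rw [← zero_add 1]
    refine mul_mem_longPathSpan I ?_ (Submodule.subset_span ⟨⟨a, b, p⟩, hp, rfl⟩)
    rw [longPathSpan_zero]
    trivial
  have h2 : ∀ n, (y * pathClass I p) ^ n ∈ longPathSpan I n := by
    intro n
    induction n with
    | zero => rw [longPathSpan_zero]; trivial
    | succ n ih => rw [pow_succ]; exact mul_mem_longPathSpan I ih h1
  have h3 : longPathSpan I N = ⊥ := by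
    rw [eq_bot_iff, longPathSpan, Submodule.span_le]
    rintro _ ⟨q, hq, rfl⟩
    exact Ideal.Quotient.eq_zero_iff_mem.2 (hN q hq)
  have h4 : IsNilpotent (y * pathClass I p) := ⟨N, by simpa [h3] using h2 N⟩
  obtain ⟨z, hz⟩ := h4.isUnit_one_add.exists_left_inv
  refine ⟨z, ?_⟩
  rw [Ideal.mem_bot, ← sub_eq_zero.2 hz]
  noncomm_ring

/-- An element of `Λ e`, for a vertex `e`, is a multiple of `e` up to an element of the radical. -/
lemma exists_mul_vertexIdem_sub_mem (hI : PathAlgebra.IsRelationIdeal I) (a : Q)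
    (x : PathAlgebra K Q ⧸ I) :
    ∃ k : K, x * vertexIdem I a - k • vertexIdem I a ∈ Ring.jacobson (PathAlgebra K Q ⧸ I) := by
  induction x using pathClass_induction I with
  | zero => exact ⟨0, by simp⟩
  | add x y hx hy =>
    obtain ⟨k, hk⟩ := hx
    obtain ⟨k', hk'⟩ := hy
    refine ⟨k + k', ?_⟩
    rw [add_mul, add_smul, add_sub_add_comm]
    exact add_mem hk hk'
  | smul c x hx =>
    obtain ⟨k, hk⟩ := hx
    refine ⟨c * k, ?_⟩
    rw [smul_mul_assoc, mul_smul, ← smul_sub, ← smul_one_mul c (x * _ - _)]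
    exact Ideal.mul_mem_left _ _ hk
  | path b c p =>
    by_cases h : a = b
    · subst h
      rw [pathClass_mul_vertexIdem]
      rcases Nat.eq_zero_or_pos p.length with hp | hp
      · obtain rfl := Quiver.Path.eq_of_length_zero p hp
        obtain rfl := Quiver.Path.eq_nil_of_length_zero p hp
        refine ⟨1, ?_⟩
        rw [one_smul, ← vertexIdem, sub_self]
        exact zero_mem _
      · exact ⟨0, by simpa using pathClass_mem_jacobson hI p hp⟩
    · exact ⟨0, by rw [vertexIdem, pathClass_mul_of_ne I p _ h]; simp⟩

end PathClass

section Jacobson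

variable {R : Type*} [Ring R] {M : Type*} [AddCommGroup M] [Module R M]

lemma exists_left_inv_one_add_of_mem_jacobson {r : R} (hr : r ∈ Ring.jacobson R) :
    ∃ u : R, u * (1 + r) = 1 := by
  rw [← Ideal.jacobson_bot] at hr
  obtain ⟨s, hs⟩ := Ideal.exists_mul_add_sub_mem_of_mem_jacobson r hr
  exact ⟨s, by rw [add_comm]; exact sub_eq_zero.1 hs⟩

/-- The case of Nakayama's lemma of a module with one generator. -/
lemma eq_zero_of_eq_smul_of_mem_jacobson {r : R} (hr : r ∈ Ring.jacobson R) {x : M}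
    (h : x = r • x) : x = 0 := by
  obtain ⟨u, hu⟩ := exists_left_inv_one_add_of_mem_jacobson (neg_mem hr)
  rw [← one_smul R x, ← hu, mul_smul, add_smul, one_smul, neg_smul, ← h, add_neg_cancel, smul_zero]

end Jacobson

/-! ### The simple modules of the vertices -/

section VertexSimple

variable {K : Type w} {Q : Type u} [Field K] [Quiver.{v} Q] [Fintype Q]
variable {I : Ideal (PathAlgebra K Q)} [I.IsTwoSided]
variable {M : Type*} [AddCommGroup M] [Module (PathAlgebra K Q ⧸ I) M]

lemma vertexIdem_mem (a : Q) : vertexIdem I a ∈ projLeft I a :=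
  Ideal.mem_span_singleton_self _

lemma mul_vertexIdem_of_mem {a : Q} {x : PathAlgebra K Q ⧸ I} (hx : x ∈ projLeft I a) :
    x * vertexIdem I a = x := by
  obtain ⟨y, rfl⟩ := Ideal.mem_span_singleton'.1 hx
  rw [mul_assoc, vertexIdem_mul_self]

lemma mem_radLeft {a : Q} {x : PathAlgebra K Q ⧸ I} :
    x ∈ radLeft I a ↔ ∃ j ∈ Ring.jacobson (PathAlgebra K Q ⧸ I), j * vertexIdem I a = x :=
  Iff.rfl

/-- A nonzero cyclic module which is annihilated by the radical, with a generator fixed by the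
idempotent of the vertex `a`, is the simple module of `a`. -/
lemma nonempty_equiv_vertexSimple (hI : PathAlgebra.IsRelationIdeal I) {a : Q} {x : M}
    (hx0 : x ≠ 0) (hx : vertexIdem I a • x = x)
    (hgen : ∀ y : M, ∃ r : PathAlgebra K Q ⧸ I, r • x = y)
    (hJ : ∀ j ∈ Ring.jacobson (PathAlgebra K Q ⧸ I), j • x = 0) :
    Nonempty (M ≃ₗ[PathAlgebra K Q ⧸ I] vertexSimple I a) := by
  let f : projLeft I a →ₗ[PathAlgebra K Q ⧸ I] M :=
    LinearMap.toSpanSingleton _ _ x ∘ₗ (projLeft I a).subtype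
  have hf : ∀ y, f y = (y : PathAlgebra K Q ⧸ I) • x := fun y => rfl
  have hsurj : Function.Surjective f := by
    intro y
    obtain ⟨r, rfl⟩ := hgen y
    refine ⟨⟨r * vertexIdem I a, Ideal.mul_mem_left _ _ (vertexIdem_mem a)⟩, ?_⟩
    rw [hf, mul_smul, hx]
  have hker : LinearMap.ker f = (radLeft I a).submoduleOf (projLeft I a) := by
    ext ⟨y, hy⟩
    rw [LinearMap.mem_ker, hf]
    refine Iff.trans ?_ (mem_radLeft (x := y)).symm
    constructor
    · intro h
      obtain ⟨k, hk⟩ := exists_mul_vertexIdem_sub_mem hI a y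
      rw [mul_vertexIdem_of_mem hy] at hk
      have h1 := hJ _ hk
      rw [sub_smul, h, zero_sub, neg_eq_zero, ← smul_one_mul k (vertexIdem I a), mul_smul,
        hx] at h1
      have hk0 : k = 0 := by
        by_contra hk0
        apply hx0
        have h2 : (k⁻¹ • (1 : PathAlgebra K Q ⧸ I)) • (k • (1 : PathAlgebra K Q ⧸ I)) • x = x := by
          rw [← mul_smul, smul_mul_smul_comm, inv_mul_cancel₀ hk0, one_mul, one_smul, one_smul]
        rw [← h2, h1, smul_zero]
      rw [hk0, zero_smul, sub_zero] at hk
      exact ⟨y, hk, mul_vertexIdem_of_mem hy⟩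
    · rintro ⟨j, hj, rfl⟩
      rw [mul_smul, hx, hJ j hj]
  exact ⟨((Submodule.quotEquivOfEq _ _ hker.symm).trans
    (f.quotKerEquivOfSurjective hsurj)).symm⟩

/-- The structure of a module isomorphic to the simple module of the vertex `a`. -/
lemma exists_generator_of_equiv_vertexSimple (hI : PathAlgebra.IsRelationIdeal I) {a : Q}
    (φ : M ≃ₗ[PathAlgebra K Q ⧸ I] vertexSimple I a) :
    ∃ x : M, x ≠ 0 ∧ vertexIdem I a • x = x ∧
      (∀ y : M, ∃ k : K, y = (k • (1 : PathAlgebra K Q ⧸ I)) • x) ∧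
      ∀ j ∈ Ring.jacobson (PathAlgebra K Q ⧸ I), ∀ y : M, j • y = 0 := by
  let s : vertexSimple I a := Submodule.Quotient.mk ⟨vertexIdem I a, vertexIdem_mem a⟩
  have hs0 : s ≠ 0 := by
    intro h
    have h1 := (Submodule.Quotient.mk_eq_zero _).1 h
    obtain ⟨j, hj, h2⟩ := mem_radLeft.1 h1
    exact vertexIdem_ne_zero hI a (eq_zero_of_eq_smul_of_mem_jacobson hj h2.symm)
  have hs1 : vertexIdem I a • s = s := by
    refine congrArg Submodule.Quotient.mk (Subtype.ext ?_)
    exact vertexIdem_mul_self I a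
  have hsk : ∀ y : vertexSimple I a, ∃ k : K, y = (k • (1 : PathAlgebra K Q ⧸ I)) • s := by
    intro y
    obtain ⟨⟨y, hy⟩, rfl⟩ := Submodule.Quotient.mk_surjective _ y
    obtain ⟨k, hk⟩ := exists_mul_vertexIdem_sub_mem hI a y
    rw [mul_vertexIdem_of_mem hy] at hk
    refine ⟨k, (Submodule.Quotient.eq _).2 (mem_radLeft.2 ⟨_, hk, ?_⟩)⟩
    rw [sub_mul, mul_vertexIdem_of_mem hy, smul_mul_assoc, vertexIdem_mul_self,
      ← smul_one_mul k (vertexIdem I a)]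
    rfl
  have hsj : ∀ j ∈ Ring.jacobson (PathAlgebra K Q ⧸ I), ∀ y : vertexSimple I a, j • y = 0 := by
    intro j hj y
    obtain ⟨⟨y, hy⟩, rfl⟩ := Submodule.Quotient.mk_surjective _ y
    refine (Submodule.Quotient.mk_eq_zero _).2 (mem_radLeft.2
      ⟨j * y, Ideal.mul_mem_right _ _ hj, ?_⟩)
    rw [mul_assoc, mul_vertexIdem_of_mem hy]
    rfl
  refine ⟨φ.symm s, by simpa using hs0, ?_, fun y => ?_, fun j hj y => ?_⟩
  · rw [← map_smul, hs1]
  · obtain ⟨k, hk⟩ := hsk (φ y)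
    refine ⟨k, φ.injective ?_⟩
    rw [map_smul, LinearEquiv.apply_symm_apply, hk]
  · apply φ.injective
    rw [map_smul, hsj j hj, map_zero]

end VertexSimple

/-! ### Uniserial modules and paths -/

section UniserialPath

variable {K : Type w} {Q : Type u} [Field K] [Quiver.{v} Q] [Fintype Q]
variable {I : Ideal (PathAlgebra K Q)} [I.IsTwoSided] {l : ℕ} {e : Fin (l + 1) → Q}
variable {M : Type*} [AddCommGroup M] [Module (PathAlgebra K Q ⧸ I) M]

lemma pathClass_rightSub_succ (p : PathThrough e) (i : Fin l) :
    pathClass I (p.rightSub i.succ) =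
      pathClass I (p i).toPath * pathClass I (p.rightSub i.castSucc) := by
  rw [pathClass_mul]
  rfl

lemma pathClass_rightSub_zero (p : PathThrough e) :
    pathClass I (p.rightSub 0) = vertexIdem I (e 0) := rfl

variable [Module K M] [IsScalarTower K (PathAlgebra K Q ⧸ I) M]

lemma finrank_restrictScalars_lt [FiniteDimensional K M]
    {A B : Submodule (PathAlgebra K Q ⧸ I) M} (h : A < B) :
    Module.finrank K (A.restrictScalars K) < Module.finrank K (B.restrictScalars K) :=
  Submodule.finrank_lt_finrank_of_lt (show A.restrictScalars K < B.restrictScalars K from h)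

/-- If `x` lies at a vertex and its radical multiples lie in `N`, every element of `Λ x` outside `N`
is a unit multiple of `x`, up to a scalar, and hence generates `Λ x`. -/
lemma mem_span_singleton_of_radical_perturbation (hI : PathAlgebra.IsRelationIdeal I) {a : Q}
    {x : M} (hx : vertexIdem I a • x = x) {N : Submodule (PathAlgebra K Q ⧸ I) M}
    (hN : ∀ j ∈ Ring.jacobson (PathAlgebra K Q ⧸ I), j • x ∈ N) {y : M}
    (hy : y ∈ Submodule.span (PathAlgebra K Q ⧸ I) {x}) (hyN : y ∉ N) :
    x ∈ Submodule.span (PathAlgebra K Q ⧸ I) {y} := by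
  obtain ⟨r, rfl⟩ := Submodule.mem_span_singleton.1 hy
  obtain ⟨k, hk⟩ := exists_mul_vertexIdem_sub_mem hI a r
  set j := r * vertexIdem I a - k • vertexIdem I a with hj
  have h1 : r • x = k • x + j • x := by
    rw [hj, sub_smul, mul_smul, smul_assoc, hx, add_sub_cancel]
  have hk0 : k ≠ 0 := by
    rintro rfl
    rw [zero_smul, zero_add] at h1
    exact hyN (h1 ▸ hN j hk)
  -- `r • x = k • (1 + k⁻¹ j) • x`, and `1 + k⁻¹ j` is left invertible
  have hkj : k⁻¹ • j ∈ Ring.jacobson (PathAlgebra K Q ⧸ I) := by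
    rw [← smul_one_mul k⁻¹ j]
    exact Ideal.mul_mem_left _ _ hk
  obtain ⟨u, hu⟩ := exists_left_inv_one_add_of_mem_jacobson hkj
  refine Submodule.mem_span_singleton.2 ⟨u * (k⁻¹ • 1), ?_⟩
  rw [h1, mul_smul, smul_assoc, one_smul, smul_add, smul_smul, inv_mul_cancel₀ hk0, one_smul,
    ← smul_assoc]
  conv_lhs => rw [← one_smul (PathAlgebra K Q ⧸ I) x, smul_smul, mul_one, ← add_smul, smul_smul, hu]
  exact one_smul _ x

/-- If the right subpaths of a path through `e 0, …, e l` take a generator of a module of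
dimension at most `l + 1` to nonzero elements `xᵢ`, then the chain of the submodules `Λ xᵢ` drops
by exactly one dimension in each step; it is the radical series of the module, which therefore is
uniserial. -/
theorem isUniserialWithSeries_of_path [FiniteDimensional K M]
    (hI : PathAlgebra.IsRelationIdeal I)
    (hM : Module.finrank K M ≤ l + 1) {x₀ : M} (hx₀ : vertexIdem I (e 0) • x₀ = x₀)
    (hgen : Submodule.span (PathAlgebra K Q ⧸ I) {x₀} = ⊤) (p : PathThrough e)
    (hp : pathClass I p.toPath • x₀ ≠ 0) : IsUniserialWithSeries I e M := by
  let x : Fin (l + 1) → M := fun i => pathClass I (p.rightSub i) • x₀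
  have hxs : ∀ i : Fin l, x i.succ = pathClass I (p i).toPath • x i.castSucc := fun i => by
    simp only [x, pathClass_rightSub_succ, mul_smul]
  have hxe : ∀ i, vertexIdem I (e i) • x i = x i := fun i => by
    simp only [x, ← mul_smul, vertexIdem_mul_pathClass]
  have hx0 : ∀ i, x i ≠ 0 := by
    intro i
    induction i using Fin.reverseInduction with
    | last => exact hp
    | cast i ih => exact fun h => ih (by rw [hxs, h, smul_zero])
  let N : Fin (l + 2) → Submodule (PathAlgebra K Q ⧸ I) M :=
    Fin.snoc (α := fun _ => Submodule (PathAlgebra K Q ⧸ I) M)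
      (fun i => Submodule.span (PathAlgebra K Q ⧸ I) {x i}) ⊥
  have hNc : ∀ i : Fin (l + 1), N i.castSucc = Submodule.span (PathAlgebra K Q ⧸ I) {x i} :=
    fun i => Fin.snoc_castSucc (α := fun _ => Submodule (PathAlgebra K Q ⧸ I) M) _ _ i
  have hNl : N (Fin.last (l + 1)) = ⊥ :=
    Fin.snoc_last (α := fun _ => Submodule (PathAlgebra K Q ⧸ I) M) _ _
  have hN0 : N 0 = ⊤ := by
    rw [← Fin.castSucc_zero, hNc]
    simp only [x, pathClass_rightSub_zero, hx₀, hgen]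
  have hNs : ∀ i : Fin (l + 1), ∃ j ∈ Ring.jacobson (PathAlgebra K Q ⧸ I),
      N i.succ = Submodule.span (PathAlgebra K Q ⧸ I) {j • x i} := by
    intro i
    induction i using Fin.lastCases with
    | last => exact ⟨0, zero_mem _, by rw [zero_smul, Submodule.span_zero_singleton]; exact hNl⟩
    | cast i =>
      refine ⟨pathClass I (p i).toPath, pathClass_mem_jacobson hI _ le_rfl, ?_⟩
      rw [← hxs, Fin.succ_castSucc, hNc]
  have hxN : ∀ i, x i ∈ N i.castSucc := fun i => by
    rw [hNc]
    exact Submodule.mem_span_singleton_self _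
  have hlt : ∀ i : Fin (l + 1), N i.succ < N i.castSucc := by
    intro i
    obtain ⟨j, hj, h⟩ := hNs i
    refine lt_of_le_of_ne ?_ fun heq => hx0 i ?_
    · rw [h, Submodule.span_singleton_le_iff_mem]
      exact Submodule.smul_mem _ _ (hxN i)
    · have h1 := hxN i
      rw [← heq, h, Submodule.mem_span_singleton] at h1
      obtain ⟨r, hr⟩ := h1
      rw [← mul_smul] at hr
      exact eq_zero_of_eq_smul_of_mem_jacobson (Ideal.mul_mem_left _ r hj) hr.symm
  have hd1 : ∀ i : Fin (l + 2), Module.finrank K ((N i).restrictScalars K) + i ≤ l + 1 := by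
    intro i
    induction i using Fin.induction with
    | zero => exact ((Submodule.finrank_le _).trans hM)
    | succ i ih =>
      have := finrank_restrictScalars_lt (K := K) (hlt i)
      simp only [Fin.val_castSucc, Fin.val_succ] at ih ⊢
      omega
  have hd2 : ∀ i : Fin (l + 2), l + 1 ≤ Module.finrank K ((N i).restrictScalars K) + i := by
    intro i
    induction i using Fin.reverseInduction with
    | last => simp
    | cast i ih =>
      have := finrank_restrictScalars_lt (K := K) (hlt i)
      simp only [Fin.val_castSucc, Fin.val_succ] at ih ⊢
      omega
  -- the radical of `Λ xᵢ` contains `Λ xᵢ₊₁` and is a proper submodule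
  have hJ : ∀ i, ∀ j ∈ Ring.jacobson (PathAlgebra K Q ⧸ I), j • x i ∈ N i.succ := by
    intro i
    let P : Submodule (PathAlgebra K Q ⧸ I) M :=
      Submodule.map (LinearMap.toSpanSingleton (PathAlgebra K Q ⧸ I) M (x i))
        (Ring.jacobson (PathAlgebra K Q ⧸ I))
    have hP1 : N i.succ ≤ P := by
      obtain ⟨j, hj, h⟩ := hNs i
      rw [h, Submodule.span_singleton_le_iff_mem]
      exact ⟨j, hj, rfl⟩
    have hP2 : P < N i.castSucc := by
      refine lt_of_le_of_ne ?_ fun heq => hx0 i ?_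
      · rintro _ ⟨j, -, rfl⟩
        exact Submodule.smul_mem _ j (hxN i)
      · have h1 := hxN i
        rw [← heq] at h1
        obtain ⟨j, hj, hji⟩ := h1
        exact eq_zero_of_eq_smul_of_mem_jacobson hj hji.symm
    have h1 := finrank_restrictScalars_lt (K := K) hP2
    have h2 := hd1 i.castSucc
    have h3 := hd2 i.succ
    simp only [Fin.val_castSucc, Fin.val_succ] at h2 h3
    have h4 : (N i.succ).restrictScalars K = P.restrictScalars K :=
      Submodule.eq_of_le_of_finrank_le hP1 (by omega)
    intro j hj
    have h5 : j • x i ∈ P.restrictScalars K := ⟨j, hj, rfl⟩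
    rwa [← h4] at h5
  have hsub : ∀ B : Submodule (PathAlgebra K Q ⧸ I) M, ∃ i, B = N i := by
    intro B
    by_cases h : ∃ i : Fin (l + 1), B ≤ N i.castSucc ∧ ¬ B ≤ N i.succ
    · obtain ⟨i, h1, h2⟩ := h
      obtain ⟨y, hy, hyN⟩ := SetLike.not_le_iff_exists.1 h2
      refine ⟨i.castSucc, le_antisymm h1 ?_⟩
      have h3 := h1 hy
      rw [hNc] at h3
      rw [hNc, Submodule.span_singleton_le_iff_mem]
      exact (Submodule.span_singleton_le_iff_mem y B).2 hy
        (mem_span_singleton_of_radical_perturbation (K := K) hI (hxe i) (hJ i) h3 hyN)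
    · push Not at h
      have h1 : ∀ i, B ≤ N i := by
        intro i
        induction i using Fin.induction with
        | zero => rw [hN0]; exact le_top
        | succ i ih => exact h i ih
      refine ⟨Fin.last _, le_antisymm (h1 _) ?_⟩
      rw [hNl]
      exact bot_le
  have hanti : Antitone N := Fin.antitone_iff_succ_le.2 fun i => (hlt i).le
  refine ⟨fun A B => ?_, N, hN0, hNl, fun i => ⟨(hlt i).le, ?_⟩⟩
  · obtain ⟨i, rfl⟩ := hsub A
    obtain ⟨j, rfl⟩ := hsub B
    exact (le_total j i).imp (fun h => hanti h) fun h => hanti h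
  · refine nonempty_equiv_vertexSimple hI (x := Submodule.Quotient.mk ⟨x i, hxN i⟩) ?_ ?_ ?_ ?_
    · rw [Ne, Submodule.Quotient.mk_eq_zero]
      intro h
      refine (hlt i).not_ge ?_
      rw [hNc, Submodule.span_singleton_le_iff_mem]
      exact h
    · exact congrArg Submodule.Quotient.mk (Subtype.ext (hxe i))
    · intro y
      obtain ⟨⟨y, hy⟩, rfl⟩ := Submodule.Quotient.mk_surjective _ y
      have hy' := hy
      rw [hNc, Submodule.mem_span_singleton] at hy'
      obtain ⟨r, hr⟩ := hy'
      exact ⟨r, congrArg Submodule.Quotient.mk (Subtype.ext hr)⟩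
    · intro j hj
      exact (Submodule.Quotient.mk_eq_zero _).2 (hJ i j hj)

/-- The structure of a composition factor `N / N'` isomorphic to the simple module of `a`. -/
lemma exists_generator_of_factor_equiv (hI : PathAlgebra.IsRelationIdeal I) {a : Q}
    {N N' : Submodule (PathAlgebra K Q ⧸ I) M}
    (φ : (N ⧸ N'.submoduleOf N) ≃ₗ[PathAlgebra K Q ⧸ I] vertexSimple I a) :
    (∃ y ∈ N, y ∉ N' ∧ vertexIdem I a • y = y ∧ ∀ z ∈ N, ∃ k : K, z - k • y ∈ N') ∧
      ∀ j ∈ Ring.jacobson (PathAlgebra K Q ⧸ I), ∀ z ∈ N, j • z ∈ N' := by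
  obtain ⟨x, hx0, hx, hk, hj⟩ := exists_generator_of_equiv_vertexSimple hI φ
  obtain ⟨⟨y, hy⟩, rfl⟩ := Submodule.Quotient.mk_surjective _ x
  have hy' : vertexIdem I a • y ∈ N := Submodule.smul_mem _ _ hy
  have heq : (Submodule.Quotient.mk ⟨vertexIdem I a • y, hy'⟩ : N ⧸ N'.submoduleOf N) =
      Submodule.Quotient.mk ⟨y, hy⟩ := hx
  refine ⟨⟨vertexIdem I a • y, hy', fun h => hx0 ?_, ?_, fun z hz => ?_⟩, fun j hj' z hz => ?_⟩
  · rw [← heq]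
    exact (Submodule.Quotient.mk_eq_zero _).2 h
  · rw [← mul_smul, vertexIdem_mul_self]
  · obtain ⟨k, h⟩ := hk (Submodule.Quotient.mk ⟨z, hz⟩)
    rw [← heq] at h
    refine ⟨k, ?_⟩
    have h1 := (Submodule.Quotient.eq _).1 h
    have h2 : z - (k • (1 : PathAlgebra K Q ⧸ I)) • vertexIdem I a • y ∈ N' := h1
    rwa [smul_assoc, one_smul] at h2
  · have h1 : (Submodule.Quotient.mk ⟨j • z, N.smul_mem j hz⟩ : N ⧸ N'.submoduleOf N) = 0 :=
      hj j hj' (Submodule.Quotient.mk ⟨z, hz⟩)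
    exact (Submodule.Quotient.mk_eq_zero (N'.submoduleOf N)).1 h1

/-- If the composition factors `N₀ / N₁` and `N₁ / N₂` of a uniserial module are the simple modules
of `a` and `b`, then some arrow `a ⟶ b` takes `N₀ \ N₁` to `N₁ \ N₂`: otherwise all the paths
from `a` to `b` would take a generator of `N₀` into `N₂`, up to a multiple of itself. -/
lemma exists_arrow_of_factors (hI : PathAlgebra.IsRelationIdeal I)
    (huni : ∀ A B : Submodule (PathAlgebra K Q ⧸ I) M, A ≤ B ∨ B ≤ A) {a b : Q}
    {N₀ N₁ N₂ : Submodule (PathAlgebra K Q ⧸ I) M} (h₂₁ : N₂ ≤ N₁)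
    (φ : (N₀ ⧸ N₁.submoduleOf N₀) ≃ₗ[PathAlgebra K Q ⧸ I] vertexSimple I a)
    (ψ : (N₁ ⧸ N₂.submoduleOf N₁) ≃ₗ[PathAlgebra K Q ⧸ I] vertexSimple I b) :
    ∃ α : a ⟶ b, ∀ x ∈ N₀, x ∉ N₁ →
      pathClass I α.toPath • x ∈ N₁ ∧ pathClass I α.toPath • x ∉ N₂ := by
  obtain ⟨⟨y, hy, hyN, hye, hyk⟩, hJ₀⟩ := exists_generator_of_factor_equiv hI φ
  obtain ⟨⟨y', hy', hyN', hye', -⟩, hJ₁⟩ := exists_generator_of_factor_equiv hI ψ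
  suffices h : ∃ α : a ⟶ b, pathClass I α.toPath • y ∉ N₂ by
    obtain ⟨α, hα⟩ := h
    have hαJ : pathClass I α.toPath ∈ Ring.jacobson (PathAlgebra K Q ⧸ I) :=
      pathClass_mem_jacobson hI _ le_rfl
    refine ⟨α, fun x hx hxN => ⟨hJ₀ _ hαJ x hx, fun hcon => ?_⟩⟩
    obtain ⟨k, hk⟩ := hyk x hx
    have hk0 : k ≠ 0 := by
      rintro rfl
      rw [zero_smul, sub_zero] at hk
      exact hxN hk
    have h1 := sub_mem hcon (hJ₁ _ hαJ _ hk)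
    rw [← smul_sub, sub_sub_cancel, smul_comm] at h1
    refine hα (((N₂.restrictScalars K).smul_mem_iff hk0).1 h1)
  by_contra! hcon
  have key : ∀ r : PathAlgebra K Q ⧸ I,
      ∃ k : K, vertexIdem I b • r • y - k • vertexIdem I b • y ∈ N₂ := by
    intro r
    induction r using pathClass_induction I with
    | zero => exact ⟨0, by simp⟩
    | add r s hr hs =>
      obtain ⟨k, hk⟩ := hr
      obtain ⟨k', hk'⟩ := hs
      refine ⟨k + k', ?_⟩
      rw [add_smul, add_smul, smul_add, add_sub_add_comm]
      exact add_mem hk hk'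
    | smul c r hr =>
      obtain ⟨k, hk⟩ := hr
      refine ⟨c * k, ?_⟩
      rw [smul_assoc, smul_comm, mul_smul, ← smul_sub]
      exact (N₂.restrictScalars K).smul_mem c hk
    | path a' b' q =>
      by_cases ha : a = a'
      swap
      · refine ⟨0, ?_⟩
        have h1 : pathClass I q • y = 0 := by
          rw [← hye, ← mul_smul, vertexIdem, pathClass_mul_of_ne I q _ ha, zero_smul]
        simp [h1]
      by_cases hb : b' = b
      swap
      · refine ⟨0, ?_⟩
        rw [← mul_smul, vertexIdem, pathClass_mul_of_ne I _ q hb]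
        simp
      subst ha hb
      cases q with
      | nil => exact ⟨1, by rw [← vertexIdem, hye, hye, one_smul, sub_self]; exact zero_mem _⟩
      | cons q β =>
        refine ⟨0, ?_⟩
        rw [zero_smul, sub_zero, ← mul_smul, vertexIdem_mul_pathClass]
        rcases Nat.eq_zero_or_pos q.length with hq | hq
        · obtain rfl := Quiver.Path.eq_of_length_zero q hq
          obtain rfl := Quiver.Path.eq_nil_of_length_zero q hq
          exact hcon β
        · have h1 : pathClass I (q.cons β) = pathClass I β.toPath * pathClass I q := by
            rw [pathClass_mul]
            rfl
          rw [h1, mul_smul]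
          exact hJ₁ _ (pathClass_mem_jacobson hI _ le_rfl) _
            (hJ₀ _ (pathClass_mem_jacobson hI q hq) _ hy)
  have hspan : N₁ ≤ Submodule.span (PathAlgebra K Q ⧸ I) {y} :=
    (huni N₁ _).resolve_right fun h => hyN (h (Submodule.mem_span_singleton_self y))
  obtain ⟨r, hr⟩ := Submodule.mem_span_singleton.1 (hspan hy')
  obtain ⟨k, hk⟩ := key r
  rw [hr, hye'] at hk
  refine hyN' ?_
  have h1 : k • vertexIdem I b • y ∈ N₁ := by
    have := sub_mem hy' (h₂₁ hk)
    rwa [sub_sub_cancel] at this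
  have h2 : k • vertexIdem I b • y = 0 := by
    by_cases hab : a = b
    · subst hab
      rw [hye] at h1 ⊢
      by_cases hk0 : k = 0
      · rw [hk0, zero_smul]
      · exact absurd (((N₁.restrictScalars K).smul_mem_iff hk0).1 h1) hyN
    · rw [← hye, ← mul_smul (vertexIdem I b), vertexIdem_mul_of_ne I hab, zero_smul, smul_zero]
  rwa [h2, sub_zero] at hk

/-- A uniserial module with a generator `x₀` at the vertex `e 0` has a basis of the form
`pᵢ x₀`, where the `pᵢ` are the right subpaths of some path through `e 0, …, e l`. -/
theorem exists_path_of_isUniserialWithSeries [FiniteDimensional K M]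
    (hI : PathAlgebra.IsRelationIdeal I)
    (hU : IsUniserialWithSeries I e M) {x₀ : M} (hx₀ : vertexIdem I (e 0) • x₀ = x₀)
    (hgen : Submodule.span (PathAlgebra K Q ⧸ I) {x₀} = ⊤) :
    Module.finrank K M = l + 1 ∧ ∃ p : PathThrough e, pathClass I p.toPath • x₀ ≠ 0 ∧
      Submodule.span K (Set.range fun i => pathClass I (p.rightSub i) • x₀) = ⊤ := by
  obtain ⟨huni, c, hc0, hcl, hc⟩ := hU
  have hφ := fun i => (hc i).2.some
  have hle := fun i => (hc i).1
  have hsup : ∀ i : Fin (l + 1), ∀ x ∈ c i.castSucc, x ∉ c i.succ →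
      (c i.castSucc).restrictScalars K = (c i.succ).restrictScalars K ⊔ Submodule.span K {x} := by
    intro i x hx hxc
    obtain ⟨⟨y, hy, -, -, hk⟩, -⟩ := exists_generator_of_factor_equiv (K := K) hI (hφ i)
    refine le_antisymm (fun z hz => ?_) (sup_le (hle i) ?_)
    · obtain ⟨k, h1⟩ := hk z hz
      obtain ⟨k', h2⟩ := hk x hx
      have hk0 : k' ≠ 0 := by
        rintro rfl
        rw [zero_smul, sub_zero] at h2
        exact hxc h2
      refine Submodule.mem_sup.2 ⟨(z - k • y) - (k * k'⁻¹) • (x - k' • y),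
        sub_mem h1 (((c i.succ).restrictScalars K).smul_mem _ h2), (k * k'⁻¹) • x,
        Submodule.smul_mem _ _ (Submodule.mem_span_singleton_self x), ?_⟩
      rw [smul_sub, smul_smul, mul_assoc, inv_mul_cancel₀ hk0, mul_one]
      abel
    · rw [Submodule.span_singleton_le_iff_mem]
      exact hx
  have hd : ∀ i : Fin (l + 2), Module.finrank K ((c i).restrictScalars K) + i = l + 1 := by
    intro i
    induction i using Fin.reverseInduction with
    | last =>
      rw [hcl, Fin.val_last]
      exact Nat.add_eq_right.2 (finrank_bot K M)
    | cast i ih =>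
      obtain ⟨⟨y, hy, hyN, -⟩, -⟩ := exists_generator_of_factor_equiv (K := K) hI (hφ i)
      rw [hsup i y hy hyN, Submodule.finrank_sup_span_singleton (by exact hyN)]
      simp only [Fin.val_castSucc, Fin.val_succ] at ih ⊢
      omega
  have harr : ∀ i : Fin l, ∃ α : e i.castSucc ⟶ e i.succ, ∀ x ∈ c i.castSucc.castSucc,
      x ∉ c i.castSucc.succ → pathClass I α.toPath • x ∈ c i.castSucc.succ ∧
        pathClass I α.toPath • x ∉ c i.succ.succ := fun i =>
    exists_arrow_of_factors (K := K) hI huni (hle i.succ) (hφ i.castSucc)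
      (hφ i.succ)
  choose p hp using harr
  have hx : ∀ i : Fin (l + 1), pathClass I (PathThrough.rightSub p i) • x₀ ∈ c i.castSucc ∧
      pathClass I (PathThrough.rightSub p i) • x₀ ∉ c i.succ := by
    intro i
    induction i using Fin.induction with
    | zero =>
      rw [pathClass_rightSub_zero, hx₀, Fin.castSucc_zero, hc0]
      refine ⟨trivial, fun h => ?_⟩
      have h1 : c (Fin.succ 0) = ⊤ := by
        rwa [← top_le_iff, ← hgen, Submodule.span_singleton_le_iff_mem]
      obtain ⟨⟨y, -, hyN, -⟩, -⟩ := exists_generator_of_factor_equiv (K := K) hI (hφ 0)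
      rw [h1] at hyN
      exact hyN trivial
    | succ i ih =>
      rw [pathClass_rightSub_succ, mul_smul]
      exact hp i _ ih.1 ih.2
  refine ⟨?_, p, fun h => (hx (Fin.last l)).2 ?_, ?_⟩
  · have := hd 0
    rw [hc0] at this
    exact (finrank_top K M).symm.trans this
  · rw [h]
    exact zero_mem _
  · have h1 : ∀ i : Fin (l + 2), (c i).restrictScalars K ≤
        Submodule.span K (Set.range fun i => pathClass I (PathThrough.rightSub p i) • x₀) := by
      intro i
      induction i using Fin.reverseInduction with
      | last => rw [hcl]; exact bot_le
      | cast i ih =>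
        rw [hsup i _ (hx i).1 (hx i).2]
        refine sup_le ih ?_
        rw [Submodule.span_singleton_le_iff_mem]
        exact Submodule.subset_span ⟨i, rfl⟩
    rw [eq_top_iff]
    refine le_trans ?_ (h1 0)
    rw [hc0]
    rfl

end UniserialPath

/-! ### The submodules of `Λ e` with uniserial quotient -/

section UniserialQuotient

/-- Vectors are linearly independent if none of them is in the span of the subsequent ones. -/
lemma linearIndependent_of_notMem_span_gt {K V : Type*} [Field K] [AddCommGroup V] [Module K V]
    {n : ℕ} {x : Fin n → V} (hx : ∀ i, x i ∉ Submodule.span K (x '' Set.Ioi i)) :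
    LinearIndependent K x := by
  rw [Fintype.linearIndependent_iff]
  intro g hg i
  induction i using WellFoundedLT.induction with
  | ind i ih =>
    by_contra hgi
    refine hx i (((Submodule.span K (x '' Set.Ioi i)).smul_mem_iff hgi).1 ?_)
    have h1 : g i • x i = -∑ j ∈ Finset.univ.erase i, g j • x j := by
      rw [eq_neg_iff_add_eq_zero, Finset.add_sum_erase _ (fun j => g j • x j) (Finset.mem_univ i),
        hg]
    rw [h1]
    refine neg_mem (sum_mem fun j hj => ?_)
    rcases lt_or_gt_of_ne (Finset.ne_of_mem_erase hj) with h | h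
    · rw [ih j h, zero_smul]
      exact zero_mem _
    · exact Submodule.smul_mem _ _ (Submodule.subset_span ⟨j, h, rfl⟩)

variable {K : Type w} {Q : Type u} [Field K] [Quiver.{v} Q] [Fintype Q]
variable {I : Ideal (PathAlgebra K Q)} [I.IsTwoSided] {l : ℕ} {e : Fin (l + 1) → Q}

/-- Along a nonzero path, each right subpath is moved out of the span of the longer ones, since
these lie in the radical multiples of it. -/
lemma linearIndependent_rightSub (hI : PathAlgebra.IsRelationIdeal I) (p : PathThrough e)
    (hp : PathAlgebra.ofPath K p.toPath ∉ I) :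
    LinearIndependent K fun i => pathClass I (p.rightSub i) := by
  have hne : ∀ i, pathClass I (p.rightSub i) ≠ 0 := by
    intro i
    induction i using Fin.reverseInduction with
    | last => exact fun h => hp (Ideal.Quotient.eq_zero_iff_mem.1 h)
    | cast i ih => exact fun h => ih (by rw [pathClass_rightSub_succ, h, mul_zero])
  have hmul : ∀ i j : Fin (l + 1), i < j → ∃ r ∈ Ring.jacobson (PathAlgebra K Q ⧸ I),
      pathClass I (p.rightSub j) = r * pathClass I (p.rightSub i) := by
    intro i j hij
    induction j using Fin.induction with
    | zero => exact absurd hij (Fin.not_lt_zero i)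
    | succ j ih =>
      have hα : pathClass I (p j).toPath ∈ Ring.jacobson (PathAlgebra K Q ⧸ I) :=
        pathClass_mem_jacobson hI _ le_rfl
      rcases (Fin.le_castSucc_iff.2 hij).eq_or_lt with h | h
      · exact ⟨_, hα, by rw [h, pathClass_rightSub_succ]⟩
      · obtain ⟨r, hr, h1⟩ := ih h
        exact ⟨_, Ideal.mul_mem_left _ (pathClass I (p j).toPath) hr, by
          rw [pathClass_rightSub_succ, h1, mul_assoc]⟩
  refine linearIndependent_of_notMem_span_gt fun i hi => hne i ?_
  let P : Submodule K (PathAlgebra K Q ⧸ I) :=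
    ((Submodule.map (LinearMap.toSpanSingleton (PathAlgebra K Q ⧸ I) (PathAlgebra K Q ⧸ I)
      (pathClass I (p.rightSub i))) (Ring.jacobson (PathAlgebra K Q ⧸ I)))).restrictScalars K
  have hP : Submodule.span K ((fun i => pathClass I (p.rightSub i)) '' Set.Ioi i) ≤ P := by
    rw [Submodule.span_le]
    rintro _ ⟨j, hj, rfl⟩
    obtain ⟨r, hr, h⟩ := hmul i j hj
    exact ⟨r, hr, h.symm⟩
  obtain ⟨r, hr, h⟩ := hP hi
  exact eq_zero_of_eq_smul_of_mem_jacobson hr h.symm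

lemma finrank_subpathSpan (hI : PathAlgebra.IsRelationIdeal I) (p : PathThrough e)
    (hp : PathAlgebra.ofPath K p.toPath ∉ I) :
    Module.finrank K (subpathSpan I p) = l + 1 := by
  have h : LinearIndependent K fun i =>
      (⟨pathClass I (p.rightSub i), pathClass_mem I _⟩ : projLeft I (e 0)) :=
    LinearIndependent.of_comp ((projLeft I (e 0)).subtype.restrictScalars K)
      (linearIndependent_rightSub hI p hp)
  rw [subpathSpan, finrank_span_eq_card h, Fintype.card_fin]

/-- The residue class of `e` in `Λ e / C`. -/
noncomputable def quotGen (a : Q) (C : Submodule (PathAlgebra K Q ⧸ I) (projLeft I a)) : projLeft I a ⧸ C :=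
  Submodule.Quotient.mk ⟨vertexIdem I a, vertexIdem_mem a⟩

lemma pathClass_smul_quotGen {a b : Q} (C : Submodule (PathAlgebra K Q ⧸ I) (projLeft I a))
    (p : Quiver.Path a b) : pathClass I p • quotGen a C =
      Submodule.Quotient.mk ⟨pathClass I p, pathClass_mem I p⟩ :=
  congrArg Submodule.Quotient.mk (Subtype.ext (pathClass_mul_vertexIdem I p))

lemma vertexIdem_smul_quotGen {a : Q} (C : Submodule (PathAlgebra K Q ⧸ I) (projLeft I a)) :
    vertexIdem I a • quotGen a C = quotGen a C :=
  pathClass_smul_quotGen C _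

lemma span_quotGen {a : Q} (C : Submodule (PathAlgebra K Q ⧸ I) (projLeft I a)) :
    Submodule.span (PathAlgebra K Q ⧸ I) {quotGen a C} = ⊤ := by
  rw [eq_top_iff]
  rintro y -
  obtain ⟨⟨y, hy⟩, rfl⟩ := Submodule.Quotient.mk_surjective _ y
  exact Submodule.mem_span_singleton.2
    ⟨y, congrArg Submodule.Quotient.mk (Subtype.ext (mul_vertexIdem_of_mem hy))⟩

variable [FiniteDimensional K (PathAlgebra K Q ⧸ I)]

lemma finrank_quotient_add (a : Q) (C : Submodule (PathAlgebra K Q ⧸ I) (projLeft I a)) :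
    Module.finrank K (projLeft I a ⧸ C) + Module.finrank K C =
      Module.finrank K (projLeft I a) := by
  rw [← (Submodule.Quotient.restrictScalarsEquiv K C).finrank_eq]
  exact Submodule.finrank_quotient_add_finrank (C.restrictScalars K)

instance (a : Q) (C : Submodule (PathAlgebra K Q ⧸ I) (projLeft I a)) :
    FiniteDimensional K (projLeft I a ⧸ C) :=
  Module.Finite.equiv (Submodule.Quotient.restrictScalarsEquiv K C)

/-- The submodules of `Λ e` with a quotient of the given kind have dimension `m`, and each of them is complementary to the span of the right subpaths of some path. -/
lemma exists_mem_GUniPath (hI : PathAlgebra.IsRelationIdeal I)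
    {C : Submodule (PathAlgebra K Q ⧸ I) (projLeft I (e 0))} (hC : C ∈ GUni I e) :
    Module.finrank K C = uniDim I e ∧
      ∃ p : PathThrough e, PathAlgebra.ofPath K p.toPath ∉ I ∧ C ∈ GUniPath I p := by
  obtain ⟨h1, p, hp, hspan⟩ := exists_path_of_isUniserialWithSeries hI hC
    (vertexIdem_smul_quotGen C) (span_quotGen C)
  have h2 := finrank_quotient_add (e 0) C
  have h3 : Module.finrank K C = uniDim I e := by
    rw [uniDim]
    omega
  have hpI : PathAlgebra.ofPath K p.toPath ∉ I := fun h => hp (by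
    rw [pathClass, Ideal.Quotient.eq_zero_iff_mem.2 h, zero_smul])
  refine ⟨h3, p, hpI, h3, ?_⟩
  have hcod : subpathSpan I p ⊔ C.restrictScalars K = ⊤ := by
    rw [eq_top_iff]
    rintro y -
    let π : projLeft I (e 0) →ₗ[K] projLeft I (e 0) ⧸ C := C.mkQ.restrictScalars K
    have h4 : Submodule.map π (subpathSpan I p) = ⊤ := by
      rw [subpathSpan, Submodule.map_span, ← Set.range_comp, ← hspan]
      congr 2
      funext i
      exact (pathClass_smul_quotGen C _).symm
    obtain ⟨z, hz, hzy⟩ : π y ∈ Submodule.map π (subpathSpan I p) := h4 ▸ Submodule.mem_top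
    have h5 : z - y ∈ C := (Submodule.Quotient.eq C).1 hzy
    exact Submodule.mem_sup.2 ⟨z, hz, y - z, by
      rw [← neg_sub]
      exact neg_mem h5, add_sub_cancel z y⟩
  have h4 := finrank_subpathSpan hI p hpI
  have h5 := Submodule.finrank_sup_add_finrank_inf_eq (subpathSpan I p) (C.restrictScalars K)
  rw [hcod, finrank_top, h4] at h5
  have h6 : Module.finrank K (C.restrictScalars K) = Module.finrank K C := rfl
  refine ⟨disjoint_iff.2 (Submodule.finrank_eq_zero.1 ?_), codisjoint_iff.2 hcod⟩
  omega

lemma GUniPath_subset (hI : PathAlgebra.IsRelationIdeal I) (p : PathThrough e)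
    (hp : PathAlgebra.ofPath K p.toPath ∉ I) : GUniPath I p ⊆ GUni I e := by
  rintro C ⟨h1, h2⟩
  have h3 := finrank_subpathSpan hI p hp
  have h4 := Submodule.finrank_add_eq_of_isCompl h2
  have h5 := finrank_quotient_add (e 0) C
  have h6 : Module.finrank K (C.restrictScalars K) = Module.finrank K C := rfl
  refine isUniserialWithSeries_of_path hI (by omega) (vertexIdem_smul_quotGen C)
    (span_quotGen C) p fun h => hp ?_
  rw [pathClass_smul_quotGen, Submodule.Quotient.mk_eq_zero] at h
  have h7 : (⟨pathClass I p.toPath, pathClass_mem I _⟩ : projLeft I (e 0)) ∈ subpathSpan I p :=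
    Submodule.subset_span ⟨Fin.last l, rfl⟩
  have h8 := Submodule.disjoint_def.1 h2.disjoint _ h7 h
  exact Ideal.Quotient.eq_zero_iff_mem.1 (congrArg Subtype.val h8)

lemma iUnion_GUniPath (hI : PathAlgebra.IsRelationIdeal I) :
    (⋃ p ∈ {p : PathThrough e | PathAlgebra.ofPath K p.toPath ∉ I}, GUniPath I p) = GUni I e := by
  refine subset_antisymm (Set.iUnion₂_subset fun p hp => GUniPath_subset hI p hp) fun C hC => ?_
  obtain ⟨-, p, hp, h⟩ := exists_mem_GUniPath hI hC
  exact Set.mem_biUnion hp h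

lemma GUniPath_eq (hI : PathAlgebra.IsRelationIdeal I) (p : PathThrough e)
    (hp : PathAlgebra.ofPath K p.toPath ∉ I) :
    GUniPath I p = {C ∈ GUni I e | IsCompl (subpathSpan I p) (C.restrictScalars K)} :=
  Set.ext fun _ => ⟨fun h => ⟨GUniPath_subset hI p hp h, h.2⟩,
    fun h => ⟨(exists_mem_GUniPath hI h.1).1, h.2⟩⟩

lemma pluckerImage_GUniPath (p : PathThrough e) :
    pluckerImage I (uniDim I e) (GUniPath I p) =
      {x | ∃ W : SubspaceGrassmannian K (projLeft I (e 0)) (uniDim I e),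
        IsCompl (subpathSpan I p) W.1 ∧
          (∀ t : PathAlgebra K Q ⧸ I, ∀ w ∈ W.1,
            Algebra.lsmul K K (projLeft I (e 0)) t w ∈ W.1) ∧ plucker W = x} := by
  ext x
  constructor
  · rintro ⟨C, hC, h, rfl⟩
    exact ⟨⟨C.restrictScalars K, h⟩, hC.2, fun t w hw => C.smul_mem t hw, rfl⟩
  · rintro ⟨W, hW, ht, rfl⟩
    let C : Submodule (PathAlgebra K Q ⧸ I) (projLeft I (e 0)) :=
      { W.1 with smul_mem' := fun t w hw => ht t w hw }
    exact ⟨C, ⟨W.2, hW⟩, W.2, rfl⟩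

/-- The set given by a nonzero path `p` is the part of an affine chart over a Zariski closed set,
and the chart meets the whole variety in just this set. -/
lemma exists_affineChart_GUniPath (hI : PathAlgebra.IsRelationIdeal I) (p : PathThrough e)
    (hp : PathAlgebra.ofPath K p.toPath ∉ I) :
    ∃ (n : ℕ) (c : AffineChart K (⋀[K]^(uniDim I e) (projLeft I (e 0))) n)
      (𝔞 : Ideal (MvPolynomial (Fin n) K)),
      pluckerImage I (uniDim I e) (GUniPath I p) = c.point '' MvPolynomial.zeroLocus K 𝔞 ∧
      pluckerImage I (uniDim I e) (GUniPath I p) =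
        {x ∈ pluckerImage I (uniDim I e) (GUni I e) | x ∈ c.domain} := by
  have h1 := finrank_subpathSpan hI p hp
  have h2 := Submodule.finrank_le (subpathSpan I p)
  have h3 : Module.finrank K (subpathSpan I p) + uniDim I e =
      Module.finrank K (projLeft I (e 0)) := by
    rw [uniDim]
    omega
  obtain ⟨n, c, 𝔞, hc, h𝔞⟩ := exists_affineChart_isCompl h3
    fun t : PathAlgebra K Q ⧸ I => Algebra.lsmul K K (projLeft I (e 0)) t
  refine ⟨n, c, 𝔞, (pluckerImage_GUniPath p).trans h𝔞.symm, ?_⟩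
  rw [GUniPath_eq hI p hp]
  ext x
  constructor
  · rintro ⟨C, hC, h, rfl⟩
    exact ⟨⟨C, hC.1, h, rfl⟩, (hc _).2 hC.2⟩
  · rintro ⟨⟨C, hC, h, rfl⟩, hx⟩
    exact ⟨C, ⟨hC, (hc _).1 hx⟩, h, rfl⟩

lemma isQuasiProjective_GUni (hI : PathAlgebra.IsRelationIdeal I) :
    IsQuasiProjective (pluckerImage I (uniDim I e) (GUni I e)) := by
  choose n c 𝔞 h1 h2 using fun p : {p : PathThrough e // PathAlgebra.ofPath K p.toPath ∉ I} =>
    exists_affineChart_GUniPath hI p.1 p.2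
  let _ := projZariski K (⋀[K]^(uniDim I e) (projLeft I (e 0)))
  set X := pluckerImage I (uniDim I e) (GUni I e) with hX
  have hopen : IsOpen (⋃ p, (c p).domain \ X) := by
    refine isOpen_iUnion fun p => ?_
    have h3 : (c p).domain \ X =
        (c p).domain \ (c p).point '' MvPolynomial.zeroLocus K (𝔞 p) := by
      rw [← h1, h2]
      ext x
      simp only [Set.mem_sdiff, Set.mem_ofPred_eq]
      tauto
    rw [h3]
    exact (c p).isOpen_domain_diff_image (𝔞 p)
  refine ⟨⋃ p, (c p).domain, (⋃ p, (c p).domain \ X)ᶜ, isOpen_iUnion fun p => (c p).isOpen_domain,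
    hopen.isClosed_compl, ?_⟩
  ext x
  simp only [Set.mem_inter_iff, Set.mem_compl_iff, Set.mem_iUnion, Set.mem_sdiff, not_exists,
    not_and, not_not]
  constructor
  · intro hx
    refine ⟨?_, fun _ _ => hx⟩
    obtain ⟨C, hC, h, rfl⟩ := hx
    obtain ⟨-, p, hp, hCp⟩ := exists_mem_GUniPath hI hC
    have h3 : plucker ⟨C.restrictScalars K, h⟩ ∈ pluckerImage I (uniDim I e) (GUniPath I p) :=
      ⟨C, hCp, h, rfl⟩
    rw [h2 ⟨p, hp⟩] at h3
    exact ⟨⟨p, hp⟩, h3.2⟩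
  · rintro ⟨⟨p, hp⟩, h⟩
    exact h p hp

end UniserialQuotient

theorem corollaryB {K : Type*} [Field K] [IsAlgClosed K] {Q : Type*} [Quiver Q] [Fintype Q]
    (I : Ideal (PathAlgebra K Q)) [I.IsTwoSided] (hI : PathAlgebra.IsRelationIdeal I)
    [FiniteDimensional K (PathAlgebra K Q ⧸ I)] {l : ℕ} (e : Fin (l + 1) → Q) :
    -- all members of the set lie in the Grassmannian of `m`-dimensional subspaces
    (∀ C ∈ GUni I e, Module.finrank K C = uniDim I e) ∧
    -- the set is a quasi-projective variety
    IsQuasiProjective (pluckerImage I (uniDim I e) (GUni I e)) ∧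
    -- it is covered by the sets given by the nonzero paths
    (⋃ p ∈ {p : PathThrough e | PathAlgebra.ofPath K p.toPath ∉ I}, GUniPath I p) = GUni I e ∧
    -- which are affine and principal open subsets
    ∀ p : PathThrough e, PathAlgebra.ofPath K p.toPath ∉ I →
      IsAffineVariety (pluckerImage I (uniDim I e) (GUniPath I p)) ∧
      IsPrincipalOpen (pluckerImage I (uniDim I e) (GUni I e))
        (pluckerImage I (uniDim I e) (GUniPath I p)) := by
  refine ⟨fun C hC => (exists_mem_GUniPath hI hC).1, isQuasiProjective_GUni hI,
    iUnion_GUniPath hI, fun p hp => ?_⟩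
  obtain ⟨n, c, 𝔞, h1, h2⟩ := exists_affineChart_GUniPath hI p hp
  refine ⟨?_, 1, MvPolynomial.X c.G₀, one_pos, MvPolynomial.isHomogeneous_X K c.G₀, h2⟩
  rw [h1]
  exact c.isAffineVariety_image 𝔞
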